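/- Let $\mathcal H$ be a complex Hilbert space with $\dim\mathcal H=2$, let $B(\mathcal H)$ be the algebra of linear operators in $\mathcal H$, and let $\{S_t\}_{t\ge 0}$ be a quantum dynamical semigroup on $B(\mathcal H)$, i.e. a family of completely positive, trace-preserving linear maps $S_t\colon B(\mathcal H)\to B(\mathcal H)$ with $S_0=\mathrm{Id}$, $S_{t+s}=S_tS_s$ for $t,s\ge 0$, and $\lim_{t\downarrow 0}S_tA=A$ for all $A\in B(\mathcal H)$. For a density operator $\rho$ (positive, of unit trace) with eigenvalues $p_1,p_2$, repeated according to multiplicity, let $\mathscr E$ be any one of the following functions of $\rho$: - a Tsallis entropy $\frac{1}{1-q}\big(\sum_k p_k^q-1\big)$, $q>0$, $q\ne 1$; - a Rényi entropy $\frac{1}{1-q}\ln\sum_k p_k^q$, $q>0$, $q\neq 1$; - the von Neumann entropy $-\sum_k p_k\ln p_k$ (with $0\ln 0=0$), which is the case $q=1$ of both families; - $1-\|\rho\|_p$, $1<p\le\infty$, where $\|\rho\|_p=(\sum_k p_k^p)^{1/p}$ for $p<\infty$ and $\|\rho\|_\infty$ is the operator norm. One says that $\{S_t\}$ does not decrease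 $\mathscr E$ if $\mathscr E(S_{t+s}\rho)\ge\mathscr E(S_t\rho)$ for all density operators $\rho$ and all $t,s\ge 0$. One says that $\{S_t\}$ is a twirling semigroup if there are a locally compact, second countable, Hausdorff topological group $G$, a continuous unitary representation $\pi$ of $G$ in $\mathcal H$, and a convolution semigroup $\{\mu_t\}_{t\ge0}$ of Borel probability measures on $G$ (that is, $\mu_{t+s}=\mu_t*\mu_s$, $\mu_0=\delta_e$, and $\mu_t\to\delta_e$ weakly as $t\downarrow 0$) such that $$S_tA=\int_G\pi(g)\,A\,\pi(g)^*\,d\mu_t(g)\qquad\text{for all } t\ge 0,\ A\in B(\mathcal H).$$ Then, for each such $\mathscr E$, $\{S_t\}$ does not decrease $\mathscr E$ if and only if $\{S_t\}$ is a twirling semigroup. Moreover, if $\{S_t\}$ is a twirling semigroup, then one can always take $G=SU(2)$ and $\pi$ its defining representation (unitary matrices being identified with unitary operators in $\mathcal H$ by means of any given orthonormal basis): there is a convolution semigroup $\{\mu_t\}$ of probability measures on $SU(2)$ for which the above formula holds with this $G$ and $\pi$. -/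

import Mathlib

open MeasureTheory Filter Topology
open scoped NNReal ENNReal CStarAlgebra

universe u v

noncomputable section

section States

variable (H : Type*) [NormedAddCommGroup H] [InnerProductSpace ℂ H]

/-- Density operators in `H`: positive operators of unit trace (`0 ≤ ρ` is the Loewner order). -/
structure DensityOperator where
  op : H →L[ℂ] H
  nonneg : 0 ≤ op
  trace_eq_one : LinearMap.trace ℂ H (op : H →ₗ[ℂ] H) = 1

variable {H}

theorem DensityOperator.isSymmetric (ρ : DensityOperator H) :
    (ρ.op : H →ₗ[ℂ] H).IsSymmetric :=
  ((ContinuousLinearMap.nonneg_iff_isPositive ρ.op).1 ρ.nonneg).isSymmetric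

variable [FiniteDimensional ℂ H]

/-- The eigenvalues of a density operator, repeated according to multiplicity. -/
def DensityOperator.eigenvalues (ρ : DensityOperator H) : Fin (Module.finrank ℂ H) → ℝ :=
  ρ.isSymmetric.eigenvalues rfl

/-- The von Neumann entropy `-∑ pₖ ln pₖ` (with `0 ln 0 = 0`). -/
def vonNeumannEntropy (ρ : DensityOperator H) : ℝ :=
  -∑ k, ρ.eigenvalues k * Real.log (ρ.eigenvalues k)

/-- The Tsallis entropy of index `q > 0`; for `q = 1` it is the von Neumann entropy. -/
def tsallisEntropy (q : ℝ) (ρ : DensityOperator H) : ℝ :=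
  if q = 1 then vonNeumannEntropy ρ
  else 1 / (1 - q) * (∑ k, ρ.eigenvalues k ^ q - 1)

/-- The Rényi entropy of index `q > 0`; for `q = 1` it is the von Neumann entropy. -/
def renyiEntropy (q : ℝ) (ρ : DensityOperator H) : ℝ :=
  if q = 1 then vonNeumannEntropy ρ
  else 1 / (1 - q) * Real.log (∑ k, ρ.eigenvalues k ^ q)

/-- The Schatten `p`-norm of a density operator, `1 ≤ p ≤ ∞`; for `p = ∞` it is the operator
norm. -/
def schattenNorm (p : ℝ≥0∞) (ρ : DensityOperator H) : ℝ :=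
  if p = ∞ then ‖ρ.op‖
  else (∑ k, ρ.eigenvalues k ^ p.toReal) ^ (1 / p.toReal)

variable (H) in
/-- The Tsallis entropies and the Rényi entropies (`q > 0`), and the functions
`ρ ↦ 1 - ‖ρ‖ₚ` (`1 < p ≤ ∞`). -/
def quantumEntropies : Set (DensityOperator H → ℝ) :=
  {E | (∃ q : ℝ, 0 < q ∧ E = tsallisEntropy q) ∨
       (∃ q : ℝ, 0 < q ∧ E = renyiEntropy q) ∨
       (∃ p : ℝ≥0∞, 1 < p ∧ E = fun ρ => 1 - schattenNorm p ρ)}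

end States

/-- Quantum dynamical semigroups: continuous semigroups of completely positive, trace-preserving
linear maps on the operators of `H`. -/
structure QuantumDynamicalSemigroup (H : Type*) [NormedAddCommGroup H] [InnerProductSpace ℂ H]
    [CompleteSpace H] where
  map : ℝ≥0 → ((H →L[ℂ] H) →CP (H →L[ℂ] H))
  trace_map : ∀ (t : ℝ≥0) (A : H →L[ℂ] H),
    LinearMap.trace ℂ H (map t A : H →ₗ[ℂ] H) = LinearMap.trace ℂ H (A : H →ₗ[ℂ] H)
  map_add : ∀ (t s : ℝ≥0) (A : H →L[ℂ] H), map (t + s) A = map t (map s A)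
  map_zero : ∀ A : H →L[ℂ] H, map 0 A = A
  tendsto_zero : ∀ A : H →L[ℂ] H, Tendsto (fun t : ℝ≥0 => map t A) (𝓝[>] 0) (𝓝 A)

namespace QuantumDynamicalSemigroup

variable {H : Type*} [NormedAddCommGroup H] [InnerProductSpace ℂ H] [CompleteSpace H]

/-- The evolved state at time `t`. -/
def evolve (S : QuantumDynamicalSemigroup H) (t : ℝ≥0) (ρ : DensityOperator H) :
    DensityOperator H where
  op := S.map t ρ.op
  nonneg := map_nonneg (S.map t) ρ.nonneg
  trace_eq_one := (S.trace_map t ρ.op).trans ρ.trace_eq_one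

/-- The semigroup does not decrease `E`: it is nondecreasing in time along every trajectory. -/
def DoesNotDecrease (S : QuantumDynamicalSemigroup H) (E : DensityOperator H → ℝ) : Prop :=
  ∀ (ρ : DensityOperator H) (t s : ℝ≥0), E (S.evolve t ρ) ≤ E (S.evolve (t + s) ρ)

end QuantumDynamicalSemigroup

/-- (Continuous) convolution semigroups of probability measures on a topological group. -/
structure ConvolutionSemigroup (G : Type*) [Group G] [TopologicalSpace G] [MeasurableSpace G]
    [BorelSpace G] where
  measure : ℝ≥0 → ProbabilityMeasure G
  measure_add : ∀ t s : ℝ≥0,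
    (measure (t + s) : Measure G) = (measure t : Measure G) ∗ₘ (measure s : Measure G)
  measure_zero : (measure 0 : Measure G) = Measure.dirac 1
  tendsto_zero : Tendsto measure (𝓝[>] 0) (𝓝 (measure 0))

namespace QuantumDynamicalSemigroup

variable {H : Type*} [NormedAddCommGroup H] [InnerProductSpace ℂ H] [CompleteSpace H]

/-- `S t A = ∫ π(g) A π(g)* dμₜ(g)`, where `π` is a continuous unitary representation of `G`
in `H`. -/
def IsTwirledBy (S : QuantumDynamicalSemigroup H) {G : Type*} [Group G] [TopologicalSpace G]
    [MeasurableSpace G] [BorelSpace G] (π : G →ₜ* unitary (H →L[ℂ] H))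
    (μ : ConvolutionSemigroup G) : Prop :=
  ∀ (t : ℝ≥0) (A : H →L[ℂ] H),
    S.map t A = ∫ g, (π g : H →L[ℂ] H) * A * star (π g : H →L[ℂ] H) ∂(μ.measure t : Measure G)

/-- Twirling semigroups, with a locally compact second countable Hausdorff group `G` (in the
universe `v`). -/
def IsTwirlingSemigroup {H : Type u} [NormedAddCommGroup H] [InnerProductSpace ℂ H]
    [CompleteSpace H] (S : QuantumDynamicalSemigroup H) : Prop :=
  ∃ (G : Type v) (_ : Group G) (_ : TopologicalSpace G) (_ : IsTopologicalGroup G)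
    (_ : LocallyCompactSpace G) (_ : SecondCountableTopology G) (_ : T2Space G)
    (_ : MeasurableSpace G) (_ : BorelSpace G)
    (π : G →ₜ* unitary (H →L[ℂ] H)) (μ : ConvolutionSemigroup G), S.IsTwirledBy π μ

end QuantumDynamicalSemigroup

section SU2

/-- The group `SU(2)`, with its topology of a set of complex matrices. -/
abbrev SU2 : Type := Matrix.specialUnitaryGroup (Fin 2) ℂ

instance : MeasurableSpace SU2 := borel SU2

instance : BorelSpace SU2 := ⟨rfl⟩

variable {H : Type*} [NormedAddCommGroup H] [InnerProductSpace ℂ H] [FiniteDimensional ℂ H]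

/-- The operator in `H` whose matrix with respect to the orthonormal basis `b` is `A`. -/
def operatorOfMatrix (b : OrthonormalBasis (Fin 2) ℂ H) (A : Matrix (Fin 2) (Fin 2) ℂ) :
    H →L[ℂ] H :=
  LinearMap.toContinuousLinearMap ((LinearMap.toMatrixOrthonormal b).symm A)

theorem operatorOfMatrix_mul (b : OrthonormalBasis (Fin 2) ℂ H)
    (A B : Matrix (Fin 2) (Fin 2) ℂ) :
    operatorOfMatrix b (A * B) = operatorOfMatrix b A * operatorOfMatrix b B := by
  ext x
  simp [operatorOfMatrix, map_mul]

theorem operatorOfMatrix_one (b : OrthonormalBasis (Fin 2) ℂ H) : operatorOfMatrix b 1 = 1 := by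
  ext x
  simp [operatorOfMatrix]

theorem continuous_operatorOfMatrix (b : OrthonormalBasis (Fin 2) ℂ H) :
    Continuous (operatorOfMatrix b) :=
  LinearMap.continuous_of_finiteDimensional
    ((LinearMap.toContinuousLinearMap : (H →ₗ[ℂ] H) ≃ₗ[ℂ] (H →L[ℂ] H)).toLinearMap ∘ₗ
      (LinearMap.toMatrixOrthonormal b).symm.toAlgEquiv.toLinearMap)

theorem operatorOfMatrix_star [CompleteSpace H] (b : OrthonormalBasis (Fin 2) ℂ H)
    (A : Matrix (Fin 2) (Fin 2) ℂ) :
    operatorOfMatrix b (star A) = star (operatorOfMatrix b A) := by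
  rw [operatorOfMatrix, map_star]
  rfl

theorem operatorOfMatrix_mem_unitary [CompleteSpace H] (b : OrthonormalBasis (Fin 2) ℂ H)
    (g : SU2) : operatorOfMatrix b g.1 ∈ unitary (H →L[ℂ] H) := by
  have h := Unitary.mem_iff.1 (Matrix.specialUnitaryGroup_le_unitaryGroup g.2)
  rw [Unitary.mem_iff, ← operatorOfMatrix_star, ← operatorOfMatrix_mul, ← operatorOfMatrix_mul,
    h.1, h.2, operatorOfMatrix_one]
  exact ⟨rfl, rfl⟩

/-- The defining representation of `SU(2)` in `H`, where the unitary matrices are identified with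
the unitary operators by means of the orthonormal basis `b`. -/
def definingRep [CompleteSpace H] (b : OrthonormalBasis (Fin 2) ℂ H) :
    SU2 →ₜ* unitary (H →L[ℂ] H) where
  toFun g := ⟨operatorOfMatrix b g.1, operatorOfMatrix_mem_unitary b g⟩
  map_one' := Subtype.ext (operatorOfMatrix_one b)
  map_mul' g h := Subtype.ext (operatorOfMatrix_mul b g.1 h.1)
  continuous_toFun := ((continuous_operatorOfMatrix b).comp continuous_subtype_val).subtype_mk _

end SU2

end

/-! ### Entropies of a two-level state as functions of its operator norm. -/

section Entropy

variable {H : Type*} [NormedAddCommGroup H] [InnerProductSpace ℂ H]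

/-! Both properties are equivalent to unitality, `S.map t 1 = 1` for all `t`.

Entropy: a two-level state has eigenvalues `‖ρ‖` and `1 - ‖ρ‖`, and each admissible entropy is a
strictly decreasing function of `‖ρ‖` on `[1/2, 1]`. Not decreasing it thus means not increasing the
norm. The maximally mixed state is the only state of minimal norm, so it must stay fixed; conversely
a unital positive map preserves `ρ ≤ ‖ρ‖ 1` (`doesNotDecrease_iff_isUnital`).

Twirling: averages of unitary conjugations fix `1`. For the converse, write a unital channel in the
basis `1, iσ₁, iσ₂, iσ₃`. Its coefficient matrix is positive semidefinite of trace one, and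
unitality makes it real, so its eigenvectors are unit vectors of `ℝ⁴`, that is, elements of `SU(2)`,
and the channel is a mixture of conjugations by them (`exists_sum_conj_quaternionMatrix`).
Conjugation does not see the sign of an element; choosing signs so that the coefficient of `1` is
nonnegative puts the mean of the mixing measure within a multiple of the distance of the channel
from the identity.

Applied to the channel at time `2⁻ⁿ`, this gives measures `ν n` with means within `O(2⁻ⁿ)` of `1`.
The space of probability measures on `SU(2)` is compact, and the convolution powers `ν n ^ ⌊2ⁿ t⌋₊`
converge along an ultrafilter to a convolution semigroup (`exists_convolutionSemigroup_tendsto`).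
Its continuity at zero follows from the bound on the means, since only the unit mass at the identity
has mean `1`. -/

theorem exists_eigenvalues_eq_norm [FiniteDimensional ℂ H] [Nontrivial H]
    (ρ : DensityOperator H) : ∃ k, ρ.eigenvalues k = ‖ρ.op‖ := by
  have h : ‖ρ.op‖ ∈ spectrum ℝ ρ.op := CStarAlgebra.norm_mem_spectrum_of_nonneg ρ.nonneg
  have h2 : ((‖ρ.op‖ : ℝ) : ℂ) ∈ spectrum ℂ ρ.op := spectrum.algebraMap_mem ℂ h
  rw [ContinuousLinearMap.spectrum_eq, ← Module.End.hasEigenvalue_iff_mem_spectrum] at h2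
  obtain ⟨k, hk⟩ := ρ.isSymmetric.exists_eigenvalues_eq rfl h2
  exact ⟨k, Complex.ofReal_injective hk⟩

theorem DensityOperator.eigenvalues_nonneg [FiniteDimensional ℂ H] (ρ : DensityOperator H)
    (k : Fin (Module.finrank ℂ H)) : 0 ≤ ρ.eigenvalues k :=
  ((ContinuousLinearMap.nonneg_iff_isPositive ρ.op).1 ρ.nonneg).toLinearMap.nonneg_eigenvalues rfl k

theorem DensityOperator.eigenvalues_le_norm [FiniteDimensional ℂ H] (ρ : DensityOperator H)
    (k : Fin (Module.finrank ℂ H)) : ρ.eigenvalues k ≤ ‖ρ.op‖ := by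
  have h : ρ.op (ρ.isSymmetric.eigenvectorBasis rfl k)
      = (ρ.eigenvalues k : ℂ) • ρ.isSymmetric.eigenvectorBasis rfl k :=
    ρ.isSymmetric.apply_eigenvectorBasis rfl k
  have h2 := ρ.op.le_opNorm (ρ.isSymmetric.eigenvectorBasis rfl k)
  rw [h, norm_smul, OrthonormalBasis.norm_eq_one, mul_one, mul_one, Complex.norm_real] at h2
  exact (le_abs_self _).trans h2

theorem DensityOperator.sum_eigenvalues [FiniteDimensional ℂ H] (ρ : DensityOperator H) :
    ∑ k, ρ.eigenvalues k = 1 := by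
  have h := ρ.isSymmetric.trace_eq_sum_eigenvalues rfl
  rw [ρ.trace_eq_one] at h
  exact Complex.ofReal_injective h.symm

/-- In dimension two, the eigenvalues of a density operator are `‖ρ‖` and `1 - ‖ρ‖`. -/
theorem DensityOperator.sum_comp_eigenvalues [FiniteDimensional ℂ H]
    (hdim : Module.finrank ℂ H = 2) (ρ : DensityOperator H) (f : ℝ → ℝ) :
    ∑ k, f (ρ.eigenvalues k) = f ‖ρ.op‖ + f (1 - ‖ρ.op‖) := by
  have hn : Nontrivial H := Module.nontrivial_of_finrank_pos (R := ℂ) (by omega)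
  have hsum (f : ℝ → ℝ) : ∑ k, f (ρ.eigenvalues k)
      = f (ρ.eigenvalues (finCongr hdim.symm 0)) + f (ρ.eigenvalues (finCongr hdim.symm 1)) := by
    rw [← Equiv.sum_comp (finCongr hdim.symm), Fin.sum_univ_two]
  have h1 := ρ.sum_eigenvalues
  rw [hsum fun x => x] at h1
  obtain ⟨k, hk⟩ := exists_eigenvalues_eq_norm ρ
  obtain ⟨j, rfl⟩ := (finCongr hdim.symm).surjective k
  rw [hsum f, ← hk]
  fin_cases j
  · simp only [Fin.zero_eta]
    congr 2
    linarith
  · simp only [Fin.mk_one]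
    rw [add_comm]
    congr 2
    linarith

theorem DensityOperator.norm_le_one [FiniteDimensional ℂ H] (hdim : Module.finrank ℂ H = 2)
    (ρ : DensityOperator H) : ‖ρ.op‖ ≤ 1 := by
  have hn : Nontrivial H := Module.nontrivial_of_finrank_pos (R := ℂ) (by omega)
  obtain ⟨k, hk⟩ := exists_eigenvalues_eq_norm ρ
  rw [← hk, ← ρ.sum_eigenvalues]
  exact Finset.single_le_sum (fun i _ => ρ.eigenvalues_nonneg i) (Finset.mem_univ k)

theorem DensityOperator.half_le_norm [FiniteDimensional ℂ H] (hdim : Module.finrank ℂ H = 2)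
    (ρ : DensityOperator H) : 1 / 2 ≤ ‖ρ.op‖ := by
  have h : ∑ k, ρ.eigenvalues k ≤ ∑ _k : Fin (Module.finrank ℂ H), ‖ρ.op‖ :=
    Finset.sum_le_sum fun k _ => ρ.eigenvalues_le_norm k
  rw [ρ.sum_eigenvalues, Finset.sum_const, Finset.card_univ, Fintype.card_fin, hdim] at h
  simp at h
  linarith

/-- For `1/2 ≤ x < y ≤ 1` the points `x` and `1 - x` are proper convex combinations of `y` and `1 -
y` with interchanged weights; adding the two strict concavity inequalities gives the claim. -/
theorem StrictConcaveOn.strictAntiOn_add_one_sub {f : ℝ → ℝ}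
    (hf : StrictConcaveOn ℝ (Set.Icc 0 1) f) :
    StrictAntiOn (fun x => f x + f (1 - x)) (Set.Icc (1 / 2) 1) := by
  intro x hx y hy hxy
  obtain ⟨hx1, hx2⟩ := hx
  obtain ⟨hy1, hy2⟩ := hy
  have hd : 0 < 2 * y - 1 := by linarith
  have hy0 : y ∈ Set.Icc (0 : ℝ) 1 := ⟨by linarith, hy2⟩
  have hy0' : 1 - y ∈ Set.Icc (0 : ℝ) 1 := ⟨by linarith, by linarith⟩
  have hd0 : 2 * y - 1 ≠ 0 := hd.ne'
  have hne : y ≠ 1 - y := by intro h; linarith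
  have ha : 0 < (x + y - 1) / (2 * y - 1) := div_pos (by linarith) hd
  have hb : 0 < (y - x) / (2 * y - 1) := div_pos (by linarith) hd
  have hab : (x + y - 1) / (2 * y - 1) + (y - x) / (2 * y - 1) = 1 := by
    rw [← add_div, div_eq_iff hd0]; ring
  have h1 := hf.2 hy0 hy0' hne ha hb hab
  have h2 := hf.2 hy0' hy0 hne.symm ha hb hab
  have e1 : (x + y - 1) / (2 * y - 1) * y + (y - x) / (2 * y - 1) * (1 - y) = x := by
    rw [div_mul_eq_mul_div, div_mul_eq_mul_div, ← add_div, div_eq_iff hd0]; ring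
  have e2 : (x + y - 1) / (2 * y - 1) * (1 - y) + (y - x) / (2 * y - 1) * y = 1 - x := by
    rw [div_mul_eq_mul_div, div_mul_eq_mul_div, ← add_div, div_eq_iff hd0]; ring
  simp only [smul_eq_mul, e1, e2] at h1 h2
  have e3 : (x + y - 1) / (2 * y - 1) = 1 - (y - x) / (2 * y - 1) := by linarith
  rw [e3] at h1 h2
  show f y + f (1 - y) < f x + f (1 - x)
  nlinarith

theorem strictAntiOn_rpow_add_one_sub {q : ℝ} (hq : 0 < q) (hq1 : q < 1) :
    StrictAntiOn (fun x : ℝ => x ^ q + (1 - x) ^ q) (Set.Icc (1 / 2) 1) :=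
  StrictConcaveOn.strictAntiOn_add_one_sub
    ((Real.strictConcaveOn_rpow hq hq1).subset Set.Icc_subset_Ici_self (convex_Icc 0 1))

theorem strictMonoOn_rpow_add_one_sub {q : ℝ} (hq : 1 < q) :
    StrictMonoOn (fun x : ℝ => x ^ q + (1 - x) ^ q) (Set.Icc (1 / 2) 1) := by
  have h := StrictConcaveOn.strictAntiOn_add_one_sub
    ((strictConvexOn_rpow hq).subset Set.Icc_subset_Ici_self (convex_Icc 0 1)).neg
  intro x hx y hy hxy
  have := h hx hy hxy
  simp only [Pi.neg_apply] at this
  show x ^ q + (1 - x) ^ q < y ^ q + (1 - y) ^ q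
  linarith

theorem rpow_add_one_sub_pos {q x : ℝ} (hx : x ∈ Set.Icc (1 / 2 : ℝ) 1) :
    0 < x ^ q + (1 - x) ^ q :=
  add_pos_of_pos_of_nonneg (Real.rpow_pos_of_pos (by linarith [hx.1]) _)
    (Real.rpow_nonneg (by linarith [hx.2]) _)

/-- In dimension two, the entropies are strictly decreasing functions of the operator norm. -/
theorem exists_strictAntiOn_of_mem_quantumEntropies [FiniteDimensional ℂ H]
    (hdim : Module.finrank ℂ H = 2) {E : DensityOperator H → ℝ} (hE : E ∈ quantumEntropies H) :
    ∃ f : ℝ → ℝ, StrictAntiOn f (Set.Icc (1 / 2) 1) ∧ ∀ ρ, E ρ = f ‖ρ.op‖ := by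
  have hvN : ∃ f : ℝ → ℝ, StrictAntiOn f (Set.Icc (1 / 2) 1) ∧
      ∀ ρ : DensityOperator H, vonNeumannEntropy ρ = f ‖ρ.op‖ := by
    refine ⟨_, StrictConcaveOn.strictAntiOn_add_one_sub
      (Real.strictConcaveOn_negMulLog.subset Set.Icc_subset_Ici_self (convex_Icc 0 1)), ?_⟩
    intro ρ
    rw [vonNeumannEntropy, ← Finset.sum_neg_distrib, ← ρ.sum_comp_eigenvalues hdim]
    simp [Real.negMulLog]
  obtain ⟨q, hq, rfl⟩ | ⟨q, hq, rfl⟩ | ⟨p, hp, rfl⟩ := hE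
  · by_cases h1 : q = 1
    · simpa [tsallisEntropy, h1] using hvN
    · refine ⟨fun x => 1 / (1 - q) * (x ^ q + (1 - x) ^ q - 1), ?_, fun ρ => ?_⟩
      · intro x hx y hy hxy
        obtain h | h := lt_or_gt_of_ne h1
        · have := strictAntiOn_rpow_add_one_sub hq h hx hy hxy
          exact mul_lt_mul_of_pos_left (sub_lt_sub_right this 1)
            (one_div_pos.2 (by linarith))
        · have := strictMonoOn_rpow_add_one_sub h hx hy hxy
          exact mul_lt_mul_of_neg_left (sub_lt_sub_right this 1)
            (one_div_neg.2 (by linarith))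
      · rw [tsallisEntropy, if_neg h1, ρ.sum_comp_eigenvalues hdim (fun x => x ^ q)]
  · by_cases h1 : q = 1
    · simpa [renyiEntropy, h1] using hvN
    · refine ⟨fun x => 1 / (1 - q) * Real.log (x ^ q + (1 - x) ^ q), ?_, fun ρ => ?_⟩
      · intro x hx y hy hxy
        obtain h | h := lt_or_gt_of_ne h1
        · have := strictAntiOn_rpow_add_one_sub hq h hx hy hxy
          exact mul_lt_mul_of_pos_left (Real.log_lt_log (rpow_add_one_sub_pos hy) this)
            (one_div_pos.2 (by linarith))
        · have := strictMonoOn_rpow_add_one_sub h hx hy hxy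
          exact mul_lt_mul_of_neg_left (Real.log_lt_log (rpow_add_one_sub_pos hx) this)
            (one_div_neg.2 (by linarith))
      · rw [renyiEntropy, if_neg h1, ρ.sum_comp_eigenvalues hdim (fun x => x ^ q)]
  · by_cases h1 : p = ∞
    · exact ⟨fun x => 1 - x, fun x _ y _ hxy => sub_lt_sub_left hxy 1,
        fun ρ => by simp [schattenNorm, h1]⟩
    · have hq : 1 < p.toReal := by
        rw [← ENNReal.toReal_one]
        exact (ENNReal.toReal_lt_toReal ENNReal.one_ne_top h1).2 hp
      refine ⟨fun x => 1 - (x ^ p.toReal + (1 - x) ^ p.toReal) ^ (1 / p.toReal), ?_, fun ρ => ?_⟩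
      · intro x hx y hy hxy
        exact sub_lt_sub_left (Real.rpow_lt_rpow (rpow_add_one_sub_pos hx).le
          (strictMonoOn_rpow_add_one_sub hq hx hy hxy) (one_div_pos.2 (by linarith))) 1
      · simp only [schattenNorm, if_neg h1]
        rw [ρ.sum_comp_eigenvalues hdim (fun x => x ^ p.toReal)]

theorem eq_zero_of_nonneg_of_trace_eq_zero [FiniteDimensional ℂ H] {A : H →L[ℂ] H} (hA : 0 ≤ A)
    (htr : LinearMap.trace ℂ H (A : H →ₗ[ℂ] H) = 0) : A = 0 := by
  have hpos := (ContinuousLinearMap.nonneg_iff_isPositive A).1 hA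
  have hs : (A : H →ₗ[ℂ] H).IsSymmetric := hpos.isSymmetric
  have h1 := hs.trace_eq_sum_eigenvalues rfl
  rw [htr] at h1
  have h2 : ∑ k, hs.eigenvalues rfl k = 0 := by
    exact Complex.ofReal_injective h1.symm
  rw [Finset.sum_eq_zero_iff_of_nonneg
    fun k _ => hpos.toLinearMap.nonneg_eigenvalues rfl k] at h2
  have h3 : (A : H →ₗ[ℂ] H) = 0 := by
    refine (hs.eigenvectorBasis rfl).toBasis.ext fun k => ?_
    have := hs.apply_eigenvectorBasis rfl k
    rw [h2 k (Finset.mem_univ k)] at this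
    simpa using this
  ext x
  exact congrArg (fun f : H →ₗ[ℂ] H => f x) h3

/-- The maximally mixed state. -/
noncomputable def maximallyMixed [FiniteDimensional ℂ H] (hdim : Module.finrank ℂ H = 2) :
    DensityOperator H where
  op := algebraMap ℝ (H →L[ℂ] H) (1 / 2)
  nonneg := algebraMap_nonneg _ (by norm_num)
  trace_eq_one := by
    have : (algebraMap ℝ (H →L[ℂ] H) (1 / 2) : H →ₗ[ℂ] H) = (1 / 2 : ℂ) • LinearMap.id := by
      ext x
      simp [Algebra.algebraMap_eq_smul_one]
      rw [← Complex.coe_smul]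
      simp
    rw [this, map_smul, LinearMap.trace_id, hdim]
    norm_num

/-- The difference `1/2 - ρ` is positive and has trace zero, hence vanishes. -/
theorem DensityOperator.eq_of_norm_le_half [FiniteDimensional ℂ H]
    (hdim : Module.finrank ℂ H = 2) (ρ : DensityOperator H) (h : ‖ρ.op‖ ≤ 1 / 2) :
    ρ.op = algebraMap ℝ (H →L[ℂ] H) (1 / 2) := by
  have h1 := (CStarAlgebra.norm_le_iff_le_algebraMap ρ.op (by norm_num) ρ.nonneg).1 h
  have h2 := eq_zero_of_nonneg_of_trace_eq_zero (sub_nonneg.2 h1) (by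
    have := (maximallyMixed (H := H) hdim).trace_eq_one
    simp only [maximallyMixed] at this
    rw [ContinuousLinearMap.toLinearMap_sub, map_sub, ρ.trace_eq_one, this, sub_self])
  exact (sub_eq_zero.1 h2).symm

/-! ### Monotonicity of the entropy is equivalent to unitality. -/

namespace QuantumDynamicalSemigroup

variable [CompleteSpace H]

/-- A semigroup is unital if it fixes the identity. -/
def IsUnital (S : QuantumDynamicalSemigroup H) : Prop := ∀ t, S.map t 1 = 1

theorem map_algebraMap (S : QuantumDynamicalSemigroup H) (t : ℝ≥0) (c : ℝ) :
    S.map t (algebraMap ℝ (H →L[ℂ] H) c) = (c : ℂ) • S.map t 1 := by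
  rw [← map_smul, Algebra.algebraMap_eq_smul_one, Complex.coe_smul]

theorem IsUnital.norm_evolve_le {S : QuantumDynamicalSemigroup H} (hS : S.IsUnital) (t : ℝ≥0)
    (ρ : DensityOperator H) : ‖(S.evolve t ρ).op‖ ≤ ‖ρ.op‖ := by
  have h1 := (CStarAlgebra.norm_le_iff_le_algebraMap ρ.op (norm_nonneg _) ρ.nonneg).1 le_rfl
  have h2 : S.map t ρ.op ≤ S.map t (algebraMap ℝ (H →L[ℂ] H) ‖ρ.op‖) := OrderHomClass.mono _ h1
  rw [map_algebraMap, hS t, Complex.coe_smul, ← Algebra.algebraMap_eq_smul_one] at h2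
  exact (CStarAlgebra.norm_le_iff_le_algebraMap _ (norm_nonneg _) (S.evolve t ρ).nonneg).2 h2

theorem doesNotDecrease_iff_isUnital [FiniteDimensional ℂ H] (hdim : Module.finrank ℂ H = 2)
    (S : QuantumDynamicalSemigroup H) {E : DensityOperator H → ℝ}
    (hE : E ∈ quantumEntropies H) : S.DoesNotDecrease E ↔ S.IsUnital := by
  obtain ⟨f, hf, hfE⟩ := exists_strictAntiOn_of_mem_quantumEntropies hdim hE
  have hmem (ρ : DensityOperator H) : ‖ρ.op‖ ∈ Set.Icc (1 / 2 : ℝ) 1 :=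
    ⟨ρ.half_le_norm hdim, ρ.norm_le_one hdim⟩
  constructor
  · intro h t
    -- The maximally mixed state starts at the minimal norm `1/2`, so it can only stay there.
    have h1 := h (maximallyMixed hdim) 0 t
    rw [zero_add, hfE, hfE, hf.le_iff_ge (hmem _) (hmem _)] at h1
    have hn : Nontrivial H := Module.nontrivial_of_finrank_pos (R := ℂ) (by omega)
    have h2 : ‖(S.evolve 0 (maximallyMixed hdim)).op‖ = 1 / 2 := by
      have : (S.evolve 0 (maximallyMixed hdim)).op = algebraMap ℝ (H →L[ℂ] H) (1 / 2) :=
        S.map_zero _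
      rw [this, norm_algebraMap']
      norm_num
    have h3 : S.map t (algebraMap ℝ (H →L[ℂ] H) (1 / 2)) = _ :=
      (S.evolve t (maximallyMixed hdim)).eq_of_norm_le_half hdim (h1.trans h2.le)
    rw [map_algebraMap, Algebra.algebraMap_eq_smul_one, ← Complex.coe_smul] at h3
    exact smul_right_injective _ (by norm_num) h3
  · intro h ρ t s
    rw [hfE, hfE, hf.le_iff_ge (hmem _) (hmem _)]
    have : (S.evolve (t + s) ρ).op = (S.evolve s (S.evolve t ρ)).op := by
      show S.map (t + s) ρ.op = S.map s (S.map t ρ.op)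
      rw [add_comm, S.map_add]
    rw [this]
    exact h.norm_evolve_le s _

end QuantumDynamicalSemigroup

end Entropy

/-! ### Convolution of probability measures on compact groups, and limits of convolution powers. -/

section Convolution

theorem Continuous.integrable_of_compactSpace {X E : Type*} [TopologicalSpace X] [CompactSpace X]
    [MeasurableSpace X] [OpensMeasurableSpace X]
    [NormedAddCommGroup E] {f : X → E} (hf : Continuous f) (μ : Measure X) [IsFiniteMeasure μ] :
    Integrable f μ :=
  hf.integrable_of_hasCompactSupport (HasCompactSupport.of_compactSpace f)

/-- Weak convergence is tested on bounded continuous real functions; compactness gives boundedness,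
and coordinates reduce `E` to `ℝ`. -/
theorem continuous_integral_probabilityMeasure {X E : Type*} [TopologicalSpace X] [CompactSpace X]
    [MeasurableSpace X] [OpensMeasurableSpace X] [NormedAddCommGroup E] [NormedSpace ℝ E]
    [FiniteDimensional ℝ E] {f : X → E} (hf : Continuous f) :
    Continuous fun μ : ProbabilityMeasure X => ∫ x, f x ∂(μ : Measure X) := by
  have := FiniteDimensional.complete ℝ E
  let e := (Module.finBasis ℝ E).equivFunL
  rw [← e.toHomeomorph.comp_continuous_iff, continuous_pi_iff]
  intro i
  let l : E →L[ℝ] ℝ := (ContinuousLinearMap.proj (R := ℝ) (φ := fun _ => ℝ) i).comp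
    (e : E →L[ℝ] _)
  have h (μ : ProbabilityMeasure X) : l (∫ x, f x ∂(μ : Measure X)) = ∫ x, l (f x) ∂(μ : Measure X) :=
    (l.integral_comp_comm (hf.integrable_of_compactSpace _)).symm
  show Continuous fun μ : ProbabilityMeasure X => l (∫ x, f x ∂(μ : Measure X))
  simp_rw [h]
  exact ProbabilityMeasure.continuous_iff_forall_continuous_integral.1 continuous_id
    (BoundedContinuousFunction.mkOfCompact ⟨fun x => l (f x), by fun_prop⟩)

variable {G : Type*} [Group G] [TopologicalSpace G] [IsTopologicalGroup G]
  [SecondCountableTopology G] [MeasurableSpace G] [BorelSpace G]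

/-- Probability measures on a group form a monoid under convolution. -/
noncomputable instance ProbabilityMeasure.instMonoid : Monoid (ProbabilityMeasure G) where
  mul μ ν := ⟨(μ : Measure G) ∗ₘ (ν : Measure G), inferInstance⟩
  mul_assoc μ ν ρ := Subtype.ext (Measure.mconv_assoc _ _ _)
  one := ⟨Measure.dirac 1, inferInstance⟩
  one_mul μ := Subtype.ext (Measure.dirac_one_mconv _)
  mul_one μ := Subtype.ext (Measure.mconv_dirac_one _)

theorem ProbabilityMeasure.coe_mul (μ ν : ProbabilityMeasure G) :
    ((μ * ν : ProbabilityMeasure G) : Measure G) = (μ : Measure G) ∗ₘ (ν : Measure G) := rfl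

theorem ProbabilityMeasure.coe_one :
    ((1 : ProbabilityMeasure G) : Measure G) = Measure.dirac 1 := rfl

/-- Convolution is the product measure pushed forward by multiplication, and both operations are
weakly continuous. -/
instance ProbabilityMeasure.instContinuousMul [TopologicalSpace.PseudoMetrizableSpace G] :
    ContinuousMul (ProbabilityMeasure G) where
  continuous_mul :=
    (ProbabilityMeasure.continuous_map (f := fun p : G × G => p.1 * p.2)
      continuous_mul).comp ProbabilityMeasure.continuous_prod

variable [CompactSpace G]

section Transform

variable {B : Type*} [NormedRing B] [NormedAlgebra ℝ B] [FiniteDimensional ℝ B]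

/-- The integral of a continuous representation is multiplicative with respect to convolution. -/
noncomputable def integralHom (π : G →* B) (hπ : Continuous π) : ProbabilityMeasure G →* B where
  toFun μ := ∫ g, π g ∂(μ : Measure G)
  map_one' := by
    have := FiniteDimensional.complete ℝ B
    rw [ProbabilityMeasure.coe_one, integral_dirac' _ _ hπ.stronglyMeasurable, map_one]
  map_mul' μ ν := by
    have := FiniteDimensional.complete ℝ B
    rw [ProbabilityMeasure.coe_mul, integral_mconv (hπ.integrable_of_compactSpace _)]
    have h1 (x : G) : ∫ y, π (x * y) ∂(ν : Measure G) = π x * ∫ y, π y ∂(ν : Measure G) := by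
      simp_rw [map_mul]
      exact (ContinuousLinearMap.mul ℝ B (π x)).integral_comp_comm
        (hπ.integrable_of_compactSpace _)
    simp_rw [h1]
    exact ((ContinuousLinearMap.mul ℝ B).flip (∫ y, π y ∂(ν : Measure G))).integral_comp_comm
        (hπ.integrable_of_compactSpace _)

theorem integralHom_apply (π : G →* B) (hπ : Continuous π) (μ : ProbabilityMeasure G) :
    integralHom π hπ μ = ∫ g, π g ∂(μ : Measure G) := rfl

theorem continuous_integralHom (π : G →* B) (hπ : Continuous π) : Continuous (integralHom π hπ) :=
  continuous_integral_probabilityMeasure hπ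

variable [T2Space G]

/-- If `1` is the only measure with integral `1`, then measures with integrals tending to `1`
tend to `1`. -/
theorem tendsto_one_of_tendsto_integralHom {π : G →* B} {hπ : Continuous π}
    (hker : ∀ μ, integralHom π hπ μ = 1 → μ = 1) {ι : Type*} {l : Filter ι}
    {μ : ι → ProbabilityMeasure G} (h : Tendsto (fun i => integralHom π hπ (μ i)) l (𝓝 1)) :
    Tendsto μ l (𝓝 1) := by
  rw [tendsto_iff_ultrafilter]
  intro U hU
  -- Compactness of the space of probability measures provides a limit along every ultrafilter; its
  -- integral is `1`, so `hker` identifies it.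
  have h1 : Tendsto μ U (𝓝 (U.map μ).lim) := (U.map μ).le_nhds_lim
  have h2 := ((continuous_integralHom π hπ).tendsto _).comp h1
  have h3 := tendsto_nhds_unique h2 (h.mono_left hU)
  rwa [hker _ h3] at h1

end Transform

theorem norm_pow_sub_one_le {B : Type*} [NormedRing B] (x : B) (k : ℕ) :
    ‖x ^ k - 1‖ ≤ (1 + ‖x - 1‖) ^ k - 1 := by
  induction k with
  | zero => simp
  | succ k ih =>
    have h : x ^ (k + 1) - 1 = (x ^ k - 1) * (x - 1) + (x - 1) + (x ^ k - 1) := by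
      rw [pow_succ]; noncomm_ring
    have h1 := norm_mul_le (x ^ k - 1) (x - 1)
    have h2 := mul_le_mul_of_nonneg_right ih (norm_nonneg (x - 1))
    calc ‖x ^ (k + 1) - 1‖ ≤ ‖(x ^ k - 1) * (x - 1)‖ + ‖x - 1‖ + ‖x ^ k - 1‖ := by
          rw [h]; exact norm_add₃_le
      _ ≤ (1 + ‖x - 1‖) ^ (k + 1) - 1 := by rw [pow_succ]; nlinarith

/-- The bound depends on the elapsed time `t` but not on the step `1 / N`, so it survives the limit
of vanishing steps. -/
theorem norm_pow_sub_one_le_exp {B : Type*} [NormedRing B] {x : B} {C N t : ℝ} {k : ℕ}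
    (hN : 0 < N) (hC : 0 ≤ C) (hx : ‖x - 1‖ ≤ C / N) (hk : k ≤ N * t) :
    ‖x ^ k - 1‖ ≤ Real.exp (C * t) - 1 := by
  refine (norm_pow_sub_one_le x k).trans (sub_le_sub_right ?_ 1)
  have h1 : 1 + ‖x - 1‖ ≤ Real.exp (C / N) := by
    linarith [Real.add_one_le_exp (C / N)]
  calc (1 + ‖x - 1‖) ^ k ≤ Real.exp (C / N) ^ k := pow_le_pow_left₀ (by positivity) h1 k
    _ = Real.exp (k * (C / N)) := (Real.exp_nat_mul _ _).symm
    _ ≤ Real.exp (C * t) := by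
      rw [Real.exp_le_exp]
      calc k * (C / N) ≤ N * t * (C / N) := mul_le_mul_of_nonneg_right hk (by positivity)
        _ = C * t := by field_simp

theorem exists_floor_add_eq {R : Type*} [Ring R] [LinearOrder R] [IsStrictOrderedRing R]
    [FloorRing R] {a b : R} (ha : 0 ≤ a) (hb : 0 ≤ b) :
    ∃ k : ℕ, k ≤ 1 ∧ ⌊a + b⌋₊ = ⌊a⌋₊ + ⌊b⌋₊ + k := by
  have h1 : ⌊a⌋₊ + ⌊b⌋₊ ≤ ⌊a + b⌋₊ := by
    apply Nat.le_floor
    push_cast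
    exact add_le_add (Nat.floor_le ha) (Nat.floor_le hb)
  have h2 : ⌊a + b⌋₊ < ⌊a⌋₊ + ⌊b⌋₊ + 2 := by
    rw [Nat.floor_lt (add_nonneg ha hb)]
    push_cast
    have := add_lt_add (Nat.lt_floor_add_one a) (Nat.lt_floor_add_one b)
    refine this.trans_eq ?_
    rw [← one_add_one_eq_two]
    abel
  exact ⟨⌊a + b⌋₊ - (⌊a⌋₊ + ⌊b⌋₊), by omega, by omega⟩

/-- Convolution powers of measures close to `1` have a limit along an ultrafilter which is a
convolution semigroup. -/
theorem exists_convolutionSemigroup_tendsto [T2Space G]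
    [TopologicalSpace.PseudoMetrizableSpace G] {B : Type*} [NormedRing B] [NormedAlgebra ℝ B]
    [FiniteDimensional ℝ B] {π : G →* B} {hπ : Continuous π}
    (hker : ∀ μ, integralHom π hπ μ = 1 → μ = 1) (ν : ℕ → ProbabilityMeasure G) (N : ℕ → ℝ)
    (hN : Tendsto N atTop atTop) (C : ℝ)
    (hν : ∀ᶠ n in atTop, ‖integralHom π hπ (ν n) - 1‖ ≤ C / N n) :
    ∃ (μ : ConvolutionSemigroup G) (U : Ultrafilter ℕ), (U : Filter ℕ) ≤ atTop ∧
      ∀ t : ℝ≥0, Tendsto (fun n => ν n ^ ⌊N n * t⌋₊) U (𝓝 (μ.measure t)) := by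
  let U : Ultrafilter ℕ := Ultrafilter.of atTop
  have hU : (U : Filter ℕ) ≤ atTop := Ultrafilter.of_le atTop
  -- A single ultrafilter serves all times simultaneously, so no diagonal subsequence is needed.
  let m (t : ℝ≥0) : ProbabilityMeasure G := (U.map fun n => ν n ^ ⌊N n * t⌋₊).lim
  have hm (t : ℝ≥0) : Tendsto (fun n => ν n ^ ⌊N n * t⌋₊) U (𝓝 (m t)) :=
    (U.map fun n => ν n ^ ⌊N n * t⌋₊).le_nhds_lim
  have hpos : ∀ᶠ n in (U : Filter ℕ), 0 < N n := hU (hN.eventually_gt_atTop 0)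
  have hν1 : Tendsto ν U (𝓝 1) := by
    refine Tendsto.mono_left (tendsto_one_of_tendsto_integralHom hker ?_) hU
    rw [tendsto_iff_norm_sub_tendsto_zero]
    exact squeeze_zero' (Eventually.of_forall fun _ => norm_nonneg _) hν (hN.const_div_atTop C)
  have hm0 : m 0 = 1 := by
    refine tendsto_nhds_unique (hm 0) ?_
    simp
  have hadd (t s : ℝ≥0) : m (t + s) = m t * m s := by
    refine tendsto_nhds_unique (hm (t + s)) ?_
    -- Rounding `N n * (t + s)` may produce one extra factor `ν n`; it is harmless because `ν n`
    -- tends to `1`.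
    choose k hk1 hk using fun n (h : 0 < N n) => exists_floor_add_eq
      (mul_nonneg h.le t.coe_nonneg) (mul_nonneg h.le s.coe_nonneg)
    let k' : ℕ → ℕ := fun n => if h : 0 < N n then k n h else 0
    have hk' : Tendsto (fun n => ν n ^ k' n) U (𝓝 1) := by
      refine tendsto_def.2 fun s hs => ?_
      filter_upwards [tendsto_def.1 hν1 s hs] with n hn
      have : k' n ≤ 1 := by
        simp only [k']
        split_ifs
        exacts [hk1 _ _, zero_le_one]
      obtain h | h := Nat.le_one_iff_eq_zero_or_eq_one.1 this
      · simpa [h] using mem_of_mem_nhds hs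
      · simpa [h] using hn
    have h := ((hm t).mul (hm s)).mul hk'
    rw [mul_one] at h
    refine h.congr' ?_
    filter_upwards [hpos] with n hn
    rw [← pow_add, ← pow_add, NNReal.coe_add, mul_add, hk n hn]
    simp [k', hn]
  have hC : 0 ≤ max C 0 := le_max_right _ _
  -- This estimate, uniform in `n` before the limit, is what forces `m t` to tend to `1` as `t`
  -- tends to zero.
  have hbound (t : ℝ≥0) : ‖integralHom π hπ (m t) - 1‖ ≤ Real.exp (max C 0 * t) - 1 := by
    have h1 := (((continuous_integralHom π hπ).tendsto _).comp (hm t)).sub_const 1 |>.norm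
    refine le_of_tendsto h1 ?_
    filter_upwards [hU hν, hpos] with n hn hn0
    simp only [Function.comp_apply, map_pow]
    refine norm_pow_sub_one_le_exp hn0 hC (hn.trans ?_)
      (Nat.floor_le (mul_nonneg hn0.le t.coe_nonneg))
    gcongr
    exact le_max_left _ _
  refine ⟨⟨m, fun t s => by rw [hadd]; rfl, by rw [hm0]; rfl, ?_⟩, U, hU, hm⟩
  rw [hm0]
  refine tendsto_one_of_tendsto_integralHom hker ?_
  rw [tendsto_iff_norm_sub_tendsto_zero]
  refine squeeze_zero (fun _ => norm_nonneg _) hbound ?_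
  have : Continuous fun t : ℝ≥0 => Real.exp (max C 0 * t) - 1 := by fun_prop
  have h0 := (this.tendsto 0).mono_left (nhdsWithin_le_nhds (s := Set.Ioi 0))
  simpa using h0

end Convolution

/-! ### Push-forward of convolution semigroups. -/

section MapSemigroup

variable {G G' : Type*} [Group G] [TopologicalSpace G] [IsTopologicalGroup G]
  [SecondCountableTopology G] [MeasurableSpace G] [BorelSpace G]
  [Group G'] [TopologicalSpace G'] [IsTopologicalGroup G']
  [SecondCountableTopology G'] [MeasurableSpace G'] [BorelSpace G']

/-- The image of a convolution semigroup under a continuous homomorphism. -/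
noncomputable def ConvolutionSemigroup.map (μ : ConvolutionSemigroup G) (f : G →* G')
    (hf : Continuous f) : ConvolutionSemigroup G' where
  measure t := (μ.measure t).map hf.measurable.aemeasurable
  measure_add t s := by
    simp only [ProbabilityMeasure.toMeasure_map]
    rw [μ.measure_add]
    exact Measure.map_mconv_monoidHom f hf.measurable
  measure_zero := by
    rw [ProbabilityMeasure.toMeasure_map, μ.measure_zero, Measure.map_dirac' hf.measurable, map_one]
  tendsto_zero :=
    ProbabilityMeasure.tendsto_map_of_tendsto_of_continuous _ _ μ.tendsto_zero hf

end MapSemigroup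

/-! ### Compactness and topological group structure of `SU(2)`. -/

section SU2Topology

theorem isClosed_specialUnitaryGroup :
    IsClosed (Matrix.specialUnitaryGroup (Fin 2) ℂ : Set (Matrix (Fin 2) (Fin 2) ℂ)) := by
  have : (Matrix.specialUnitaryGroup (Fin 2) ℂ : Set (Matrix (Fin 2) (Fin 2) ℂ))
      = {A | A * star A = 1} ∩ {A | A.det = 1} := by
    ext A
    simp [Matrix.mem_specialUnitaryGroup_iff, Matrix.mem_unitaryGroup_iff]
  rw [this]
  exact (isClosed_eq (by fun_prop) (by fun_prop)).inter (isClosed_eq (by fun_prop) (by fun_prop))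

instance : CompactSpace SU2 := by
  have h : IsCompact (Set.univ.pi fun _ : Fin 2 => Set.univ.pi fun _ : Fin 2 =>
      Metric.closedBall (0 : ℂ) 1) :=
    isCompact_univ_pi fun _ => isCompact_univ_pi fun _ => isCompact_closedBall 0 1
  refine isCompact_iff_compactSpace.1 (h.of_isClosed_subset isClosed_specialUnitaryGroup ?_)
  intro A hA i _ j _
  simpa using entry_norm_bound_of_unitary (Matrix.specialUnitaryGroup_le_unitaryGroup hA) i j

instance : TopologicalSpace.MetrizableSpace SU2 :=
  have : TopologicalSpace.MetrizableSpace (Matrix (Fin 2) (Fin 2) ℂ) :=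
    inferInstanceAs (TopologicalSpace.MetrizableSpace (Fin 2 → Fin 2 → ℂ))
  Topology.IsEmbedding.subtypeVal.metrizableSpace

instance : SecondCountableTopology SU2 :=
  have : SecondCountableTopology (Matrix (Fin 2) (Fin 2) ℂ) :=
    inferInstanceAs (SecondCountableTopology (Fin 2 → Fin 2 → ℂ))
  inferInstanceAs (SecondCountableTopology
    {A : Matrix (Fin 2) (Fin 2) ℂ // A ∈ Matrix.specialUnitaryGroup (Fin 2) ℂ})

instance : IsTopologicalGroup SU2 where
  continuous_mul := by
    exact Continuous.subtype_mk (by fun_prop) _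
  continuous_inv := by
    exact Continuous.subtype_mk (f := fun A : SU2 => star A.1) (by fun_prop) _

theorem SU2.re_apply_zero_le (g : SU2) : (g.1 0 0).re ≤ 1 :=
  (Complex.re_le_norm _).trans
    (entry_norm_bound_of_unitary (Matrix.specialUnitaryGroup_le_unitaryGroup g.2) 0 0)

/-- The first row and the first column are unit vectors, so a corner entry with real part `1` leaves
nothing for their other entries; the determinant fixes the last entry. -/
theorem SU2.eq_one_of_re_eq_one {g : SU2} (h : (g.1 0 0).re = 1) : g = 1 := by
  have hU := Matrix.mem_unitaryGroup_iff.1 (Matrix.specialUnitaryGroup_le_unitaryGroup g.2)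
  have hU' := Matrix.mem_unitaryGroup_iff'.1 (Matrix.specialUnitaryGroup_le_unitaryGroup g.2)
  have hdet := (Matrix.mem_specialUnitaryGroup_iff.1 g.2).2
  have h00 := congrArg Complex.re (congrFun (congrFun hU 0) 0)
  have h00' := congrArg Complex.re (congrFun (congrFun hU' 0) 0)
  simp [Matrix.mul_apply, Fin.sum_univ_two, Matrix.star_apply] at h00 h00'
  have a : (g.1 0 0).im = 0 := by nlinarith [sq_nonneg (g.1 0 1).re, sq_nonneg (g.1 0 1).im]
  have b : (g.1 0 1).re = 0 := by nlinarith [sq_nonneg (g.1 0 1).re, sq_nonneg (g.1 0 1).im]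
  have c : (g.1 0 1).im = 0 := by nlinarith [sq_nonneg (g.1 0 1).re, sq_nonneg (g.1 0 1).im]
  have b' : (g.1 1 0).re = 0 := by nlinarith [sq_nonneg (g.1 1 0).re, sq_nonneg (g.1 1 0).im]
  have c' : (g.1 1 0).im = 0 := by nlinarith [sq_nonneg (g.1 1 0).re, sq_nonneg (g.1 1 0).im]
  have e00 : g.1 0 0 = 1 := Complex.ext h a
  have e01 : g.1 0 1 = 0 := Complex.ext b c
  have e10 : g.1 1 0 = 0 := Complex.ext b' c'
  rw [Matrix.det_fin_two, e00, e01, e10] at hdet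
  refine Subtype.ext (Matrix.ext fun i j => ?_)
  fin_cases i <;> fin_cases j <;> simp_all

end SU2Topology

/-! ### Unit quaternions and the coefficients of a map in the basis `1, iσ₁, iσ₂, iσ₃`. -/

section Quaternions

/-- The matrix `v₀ + i (v₁ σ₁ + v₂ σ₂ + v₃ σ₃)`. -/
def quaternionMatrix (v : Fin 4 → ℝ) : Matrix (Fin 2) (Fin 2) ℂ :=
  !![v 0 + v 3 * Complex.I, v 2 + v 1 * Complex.I; -v 2 + v 1 * Complex.I, v 0 - v 3 * Complex.I]

theorem quaternionMatrix_mem {v : Fin 4 → ℝ} (hv : ∑ i, v i ^ 2 = 1) :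
    quaternionMatrix v ∈ Matrix.specialUnitaryGroup (Fin 2) ℂ := by
  rw [Fin.sum_univ_four] at hv
  rw [Matrix.mem_specialUnitaryGroup_iff, Matrix.mem_unitaryGroup_iff]
  refine ⟨?_, ?_⟩
  · ext i j
    fin_cases i <;> fin_cases j <;>
      simp [quaternionMatrix, Matrix.mul_apply, Fin.sum_univ_two, Matrix.star_apply,
        Complex.ext_iff] <;> (try constructor) <;> nlinarith
  · simp [quaternionMatrix, Matrix.det_fin_two, Complex.ext_iff]
    constructor <;> nlinarith

/-- The Choi matrix of a linear map on matrices. -/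
def choiMatrix (Φ : Matrix (Fin 2) (Fin 2) ℂ →ₗ[ℂ] Matrix (Fin 2) (Fin 2) ℂ) :
    Matrix (Fin 2 × Fin 2) (Fin 2 × Fin 2) ℂ :=
  Matrix.of fun x y => Φ (Matrix.single x.1 y.1 1) x.2 y.2

/-- The matrices `1, i σ₁, i σ₂, i σ₃`, written as vectors. -/
def quaternionBasis : Matrix (Fin 2 × Fin 2) (Fin 4) ℂ :=
  Matrix.of fun x j => quaternionMatrix (Pi.single j 1) x.2 x.1

/-- The four basis matrices are orthogonal with squared norm `2`. Inverting on both sides produces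
the factor `1 / 4` in `processMatrix`. -/
theorem quaternionBasis_mul_conjTranspose :
    quaternionBasis * quaternionBasis.conjTranspose = (2 : ℂ) • 1 := by
  ext ⟨a, c⟩ ⟨b, d⟩
  rw [Matrix.mul_apply, Fin.sum_univ_four]
  fin_cases a <;> fin_cases b <;> fin_cases c <;> fin_cases d <;>
    simp [quaternionBasis, quaternionMatrix, Matrix.conjTranspose_apply, Pi.single_apply] <;>
    norm_num

theorem sum_quaternionBasis_mul (v : Fin 4 → ℝ) (a c : Fin 2) :
    ∑ j, quaternionBasis (a, c) j * v j = quaternionMatrix v c a := by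
  rw [Fin.sum_univ_four]
  fin_cases a <;> fin_cases c <;>
    simp [quaternionBasis, quaternionMatrix, Pi.single_apply] <;> ring

theorem quaternionMatrix_eq_sum (v : Fin 4 → ℝ) :
    quaternionMatrix v = ∑ j, (v j : ℂ) • quaternionMatrix (Pi.single j 1) := by
  ext c a
  rw [← sum_quaternionBasis_mul v]
  simp only [Matrix.sum_apply, Matrix.smul_apply, smul_eq_mul]
  exact Finset.sum_congr rfl fun j _ => mul_comm _ _

/-- The coefficients of a linear map on matrices with respect to `1, i σ₁, i σ₂, i σ₃`. -/
noncomputable def processMatrix :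
    (Matrix (Fin 2) (Fin 2) ℂ →ₗ[ℂ] Matrix (Fin 2) (Fin 2) ℂ) →ₗ[ℂ]
    Matrix (Fin 4) (Fin 4) ℂ where
  toFun Φ := (1 / 4 : ℂ) • (quaternionBasis.conjTranspose * choiMatrix Φ * quaternionBasis)
  map_add' Φ Ψ := by
    have : choiMatrix (Φ + Ψ) = choiMatrix Φ + choiMatrix Ψ := by ext; simp [choiMatrix]
    rw [this, Matrix.mul_add, Matrix.add_mul, smul_add]
  map_smul' r Φ := by
    have : choiMatrix (r • Φ) = r • choiMatrix Φ := by ext; simp [choiMatrix]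
    rw [this, Matrix.mul_smul, Matrix.smul_mul, smul_comm, RingHom.id_apply]

theorem choiMatrix_eq (Φ : Matrix (Fin 2) (Fin 2) ℂ →ₗ[ℂ] Matrix (Fin 2) (Fin 2) ℂ) :
    choiMatrix Φ = quaternionBasis * processMatrix Φ * quaternionBasis.conjTranspose := by
  have : quaternionBasis * processMatrix Φ * quaternionBasis.conjTranspose
      = (1 / 4 : ℂ) • ((quaternionBasis * quaternionBasis.conjTranspose) * choiMatrix Φ *
        (quaternionBasis * quaternionBasis.conjTranspose)) := by
    simp only [processMatrix, LinearMap.coe_mk, AddHom.coe_mk, Matrix.mul_smul, Matrix.smul_mul,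
      Matrix.mul_assoc]
  rw [this, quaternionBasis_mul_conjTranspose]
  simp [smul_smul]
  norm_num

theorem processMatrix_id : processMatrix LinearMap.id = Matrix.single 0 0 1 := by
  ext j k
  simp only [processMatrix, LinearMap.coe_mk, AddHom.coe_mk, Matrix.smul_apply, Matrix.mul_apply,
    Fintype.sum_prod_type, Fin.sum_univ_two]
  fin_cases j <;> fin_cases k <;>
    simp [choiMatrix, quaternionBasis, quaternionMatrix, Pi.single_apply, Matrix.single_apply] <;>
    norm_num

end Quaternions

/-! ### Unital qubit channels as mixtures of `SU(2)` conjugations. -/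

section Channels

open scoped ComplexOrder

/-- Let `χ` be the coefficients and `E` the basis. Hermiticity makes the imaginary part of `χ`
antisymmetric, with six free entries. Trace preservation and unitality read `∑ χ j k E k* E j = 1`
and `∑ χ j k E j E k* = 1`; their traceless parts are six real equations which annihilate those
entries. The proof checks this by linear arithmetic on the entries of the Choi matrix. -/
theorem processMatrix_im_eq_zero {Φ : Matrix (Fin 2) (Fin 2) ℂ →ₗ[ℂ] Matrix (Fin 2) (Fin 2) ℂ}
    (hΦ : (choiMatrix Φ).IsHermitian) (htr : ∀ A, (Φ A).trace = A.trace) (h1 : Φ 1 = 1)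
    (j k : Fin 4) : (processMatrix Φ j k).im = 0 := by
  obtain ⟨s, hs⟩ : ∃ s : Fin 2 → Fin 2 → Fin 2 → Fin 2 → ℂ,
    ∀ a b c d, Φ (Matrix.single a b 1) c d = s a b c d := ⟨_, fun _ _ _ _ => rfl⟩
  have ht (a b : Fin 2) : s a b 0 0 + s a b 1 1 = if a = b then 1 else 0 := by
    have := htr (Matrix.single a b 1)
    rw [Matrix.trace_fin_two, hs, hs] at this
    rw [this]
    fin_cases a <;> fin_cases b <;> simp
  have hu (c d : Fin 2) : s 0 0 c d + s 1 1 c d = if c = d then 1 else 0 := by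
    have e : (1 : Matrix (Fin 2) (Fin 2) ℂ) = Matrix.single 0 0 1 + Matrix.single 1 1 1 := by
      ext i j
      fin_cases i <;> fin_cases j <;> simp
    have := congrFun (congrFun h1 c) d
    rw [e, map_add, Matrix.add_apply, hs, hs, ← e, Matrix.one_apply] at this
    exact this
  have hh (a b c d : Fin 2) : star (s a b c d) = s b a d c := by
    have := hΦ.apply (b, d) (a, c)
    simpa only [choiMatrix, Matrix.of_apply, hs] using this
  have hre (a b c d : Fin 2) : (s a b c d).re = (s b a d c).re := by
    rw [← hh a b c d]; simp
  have him (a b c d : Fin 2) : (s a b c d).im = -(s b a d c).im := by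
    rw [← hh a b c d]; simp
  have t1 := congrArg Complex.re (ht 0 0)
  have t2 := congrArg Complex.re (ht 0 1)
  have t3 := congrArg Complex.im (ht 0 1)
  have t4 := congrArg Complex.re (ht 1 1)
  have u1 := congrArg Complex.re (hu 0 0)
  have u2 := congrArg Complex.re (hu 0 1)
  have u3 := congrArg Complex.im (hu 0 1)
  have u4 := congrArg Complex.re (hu 1 1)
  have d1 := him 0 0 0 0
  have d2 := him 0 0 1 1
  have d3 := him 1 1 0 0
  have d4 := him 1 1 1 1
  have r1 := hre 1 0 0 0
  have r2 := hre 1 0 0 1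
  have r3 := hre 1 0 1 0
  have r4 := hre 1 0 1 1
  have r5 := hre 0 0 1 0
  have r6 := hre 1 1 1 0
  have i1 := him 1 0 0 0
  have i2 := him 1 0 0 1
  have i3 := him 1 0 1 0
  have i4 := him 1 0 1 1
  have i5 := him 0 0 1 0
  have i6 := him 1 1 1 0
  simp at t1 t2 t3 t4 u1 u2 u3 u4
  simp only [processMatrix, LinearMap.coe_mk, AddHom.coe_mk, Matrix.smul_apply, Matrix.mul_apply,
    Fintype.sum_prod_type, Fin.sum_univ_two]
  fin_cases j <;> fin_cases k <;>
    simp [choiMatrix, hs, quaternionBasis, quaternionMatrix, Pi.single_apply] <;>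
    linarith

theorem trace_processMatrix {Φ : Matrix (Fin 2) (Fin 2) ℂ →ₗ[ℂ] Matrix (Fin 2) (Fin 2) ℂ}
    (htr : ∀ A, (Φ A).trace = A.trace) : (processMatrix Φ).trace = 1 := by
  have h : (processMatrix Φ).trace = (1 / 4 : ℂ) * (2 * (choiMatrix Φ).trace) := by
    simp only [processMatrix, LinearMap.coe_mk, AddHom.coe_mk, Matrix.trace_smul, smul_eq_mul]
    rw [Matrix.trace_mul_comm, ← Matrix.mul_assoc, quaternionBasis_mul_conjTranspose]
    simp
  have h2 : (choiMatrix Φ).trace = 2 := by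
    have h0 := htr (Matrix.single 0 0 1)
    have h1 := htr (Matrix.single 1 1 1)
    simp only [Matrix.trace_fin_two, Matrix.single_apply] at h0 h1
    simp only [Matrix.trace, Matrix.diag, choiMatrix, Matrix.of_apply, Fintype.sum_prod_type,
      Fin.sum_univ_two, h0, h1]
    norm_num
  rw [h, h2]
  norm_num

/-- The spectral decomposition of a real positive semidefinite matrix. -/
theorem Matrix.PosSemidef.exists_sum_eq {n : Type*} [Fintype n] [DecidableEq n]
    {X : Matrix n n ℝ} (hX : X.PosSemidef) (j₀ : n) :
    ∃ (p : n → ℝ) (v : n → n → ℝ), (∀ i, 0 ≤ p i) ∧ (∀ i, ∑ j, v i j ^ 2 = 1) ∧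
      (∀ i, 0 ≤ v i j₀) ∧ ∑ i, p i = X.trace ∧ ∀ j k, X j k = ∑ i, p i * v i j * v i k := by
  let w : n → n → ℝ := fun i j => hX.1.eigenvectorBasis i j
  have hw (i : n) : ∑ j, w i j ^ 2 = 1 := by
    have := EuclideanSpace.real_norm_sq_eq (hX.1.eigenvectorBasis i)
    rw [OrthonormalBasis.norm_eq_one] at this
    rw [← this, one_pow]
  have hXw (j k : n) : X j k = ∑ i, hX.1.eigenvalues i * w i j * w i k := by
    conv_lhs => rw [hX.1.spectral_theorem]
    rw [Unitary.conjStarAlgAut_apply, Matrix.mul_apply]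
    refine Finset.sum_congr rfl fun i _ => ?_
    rw [Matrix.mul_diagonal]
    show w i j * hX.1.eigenvalues i * w i k = _
    ring
  -- Eigenvectors enter the decomposition quadratically, so each may be multiplied by a sign.
  have hε (i : n) : ∃ ε : ℝ, ε ^ 2 = 1 ∧ 0 ≤ ε * w i j₀ := by
    obtain h | h := le_total 0 (w i j₀)
    · exact ⟨1, by norm_num, by linarith⟩
    · exact ⟨-1, by norm_num, by linarith⟩
  choose ε hε1 hε0 using hε
  refine ⟨hX.1.eigenvalues, fun i j => ε i * w i j, hX.eigenvalues_nonneg, fun i => ?_, hε0,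
    by simpa using hX.1.trace_eq_sum_eigenvalues.symm, fun j k => ?_⟩
  · rw [← hw i]
    exact Finset.sum_congr rfl fun j _ => by rw [mul_pow, hε1, one_mul]
  · rw [hXw]
    refine Finset.sum_congr rfl fun i _ => ?_
    linear_combination (-hX.1.eigenvalues i * w i j * w i k) * hε1 i

/-- A unital quantum channel on `2 × 2` matrices is a convex combination of conjugations by
elements of `SU(2)`, which are close to `1` if the channel is close to the identity. -/
theorem exists_sum_conj_quaternionMatrix
    {Φ : Matrix (Fin 2) (Fin 2) ℂ →ₗ[ℂ] Matrix (Fin 2) (Fin 2) ℂ}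
    (hΦ : (choiMatrix Φ).PosSemidef) (htr : ∀ A, (Φ A).trace = A.trace) (h1 : Φ 1 = 1) :
    ∃ (p : Fin 4 → ℝ) (v : Fin 4 → Fin 4 → ℝ), (∀ i, 0 ≤ p i) ∧ ∑ i, p i = 1 ∧
      (∀ i, ∑ j, v i j ^ 2 = 1) ∧
      (∀ A, Φ A = ∑ i, (p i : ℂ) • (quaternionMatrix (v i) * A * star (quaternionMatrix (v i)))) ∧
      ∀ j, |∑ i, p i * v i j - Pi.single (M := fun _ => ℝ) 0 1 j| ≤
        ‖processMatrix (Φ - LinearMap.id) 0 j‖ + ‖processMatrix (Φ - LinearMap.id) 0 0‖ := by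
  have hχ : (processMatrix Φ).PosSemidef :=
    (hΦ.conjTranspose_mul_mul_same quaternionBasis).smul
      (by norm_num [Complex.le_def] : (0 : ℂ) ≤ 1 / 4)
  let X : Matrix (Fin 4) (Fin 4) ℝ := (processMatrix Φ).map Complex.re
  have hXχ (j k : Fin 4) : (X j k : ℂ) = processMatrix Φ j k :=
    Complex.ext rfl (processMatrix_im_eq_zero hΦ.1 htr h1 j k).symm
  have hX : X.PosSemidef := by
    refine Matrix.PosSemidef.of_dotProduct_mulVec_nonneg ?_ fun x => ?_
    · ext j k
      have := congrArg Complex.re (hχ.1.apply j k)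
      simpa [X] using this
    · have h := hχ.dotProduct_mulVec_nonneg (fun i => (x i : ℂ))
      have e : star (fun i => (x i : ℂ)) ⬝ᵥ (processMatrix Φ).mulVec (fun i => (x i : ℂ))
          = ((star x ⬝ᵥ X.mulVec x : ℝ) : ℂ) := by
        simp [dotProduct, Matrix.mulVec, hXχ]
      rw [e] at h
      exact_mod_cast h
  obtain ⟨p, v, hp, hv, hv0, hpX, hXv⟩ := hX.exists_sum_eq 0
  have hp1 : ∑ i, p i = 1 := by
    rw [hpX]
    have := congrArg Complex.re (trace_processMatrix htr)
    simpa [Matrix.trace, X] using this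
  refine ⟨p, v, hp, hp1, hv, fun A => ?_, fun j => ?_⟩
  · let Ψ : Matrix (Fin 2) (Fin 2) ℂ →ₗ[ℂ] Matrix (Fin 2) (Fin 2) ℂ := ∑ i, (p i : ℂ) •
      LinearMap.mulLeftRight ℂ (quaternionMatrix (v i), star (quaternionMatrix (v i)))
    have hΨ (A) : Ψ A =
        ∑ i, (p i : ℂ) • (quaternionMatrix (v i) * A * star (quaternionMatrix (v i))) := by
      simp [Ψ]
    rw [← hΨ]
    refine LinearMap.congr_fun (Matrix.ext_linearMap ℂ fun a b => LinearMap.ext_ring ?_) A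
    ext c d
    have h2 : Φ (Matrix.single a b 1) c d = ∑ i, (p i : ℂ) *
        (quaternionMatrix (v i) c a * star (quaternionMatrix (v i) d b)) := by
      have h3 : Φ (Matrix.single a b 1) c d = choiMatrix Φ (a, c) (b, d) := rfl
      rw [h3, choiMatrix_eq]
      simp only [Matrix.mul_apply, ← hXχ, hXv, ← sum_quaternionBasis_mul,
        Matrix.conjTranspose_apply, Fin.sum_univ_four]
      push_cast
      simp
      ring
    have h4 : Ψ (Matrix.single a b 1) c d = ∑ i, (p i : ℂ) *
        (quaternionMatrix (v i) c a * star (quaternionMatrix (v i) d b)) := by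
      rw [hΨ]
      simp only [Matrix.sum_apply, Matrix.smul_apply, smul_eq_mul]
      refine Finset.sum_congr rfl fun i _ => ?_
      congr 1
      rw [Matrix.mul_apply]
      fin_cases a <;> fin_cases b <;>
        simp [Fin.sum_univ_two, Matrix.mul_apply, Matrix.single_apply, Matrix.star_apply]
    simpa using h2.trans h4.symm
  · have hD (k : Fin 4) : |X 0 k - Pi.single (M := fun _ => ℝ) 0 1 k|
        ≤ ‖processMatrix (Φ - LinearMap.id) 0 k‖ := by
      rw [map_sub, processMatrix_id, Matrix.sub_apply, ← hXχ, ← Real.norm_eq_abs,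
        ← Complex.norm_real]
      apply le_of_eq
      congr 1
      push_cast
      congr 1
      fin_cases k <;> simp
    have hvle (i j : Fin 4) : |v i j| ≤ 1 := by
      rw [← sq_le_one_iff_abs_le_one, ← hv i]
      exact Finset.single_le_sum (f := fun j => v i j ^ 2) (fun j _ => sq_nonneg _)
        (Finset.mem_univ j)
    -- Since `0 ≤ v i 0 ≤ 1`, one has `1 - v i 0 ≤ 1 - v i 0 ^ 2`. The sign choice thus bounds the
    -- defect of the mean by `1 - X 0 0`, which is linear in the channel.
    have h0 : ∑ i, p i * (1 - v i 0) ≤ ‖processMatrix (Φ - LinearMap.id) 0 0‖ := by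
      refine le_trans ?_ ((neg_le_abs _).trans (hD 0))
      rw [hXv, Pi.single_eq_same, neg_sub]
      have h5 : 1 - ∑ i, p i * v i 0 * v i 0 = ∑ i, (p i - p i * v i 0 * v i 0) := by
        rw [Finset.sum_sub_distrib, hp1]
      rw [h5]
      refine Finset.sum_le_sum fun i _ => ?_
      have := mul_nonneg (hp i) (mul_nonneg (hv0 i) (sub_nonneg.2 (le_of_abs_le (hvle i 0))))
      nlinarith
    -- The mean `∑ p i * v i j` is compared with `X 0 j = ∑ p i * v i 0 * v i j`; replacing the
    -- factor `v i 0` by `1` costs the last sum.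
    have hsplit : ∑ i, p i * v i j - Pi.single (M := fun _ => ℝ) 0 1 j
        = (X 0 j - Pi.single (M := fun _ => ℝ) 0 1 j) + ∑ i, p i * (1 - v i 0) * v i j := by
      rw [hXv, sub_add_eq_add_sub, ← Finset.sum_add_distrib]
      congr 1
      exact Finset.sum_congr rfl fun i _ => by ring
    rw [hsplit]
    refine (abs_add_le _ _).trans (add_le_add (hD j) (le_trans ?_ h0))
    refine (Finset.abs_sum_le_sum_abs _ _).trans (Finset.sum_le_sum fun i _ => ?_)
    have hnn : 0 ≤ p i * (1 - v i 0) :=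
      mul_nonneg (hp i) (sub_nonneg.2 (le_of_abs_le (hvle i 0)))
    rw [abs_mul, abs_of_nonneg hnn]
    exact mul_le_of_le_one_right hnn (hvle i j)

end Channels

/-! ### Finitely supported probability measures. -/

section FiniteMeasures

/-- The measure with masses `p i` at the points `x i`. -/
noncomputable def sumDirac {ι X : Type*} [Fintype ι] [MeasurableSpace X] (p : ι → ℝ)
    (hp : ∀ i, 0 ≤ p i) (hp1 : ∑ i, p i = 1) (x : ι → X) : ProbabilityMeasure X :=
  ⟨∑ i, ENNReal.ofReal (p i) • Measure.dirac (x i), ⟨by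
    simp [← ENNReal.ofReal_sum_of_nonneg fun i _ => hp i, hp1]⟩⟩

theorem integral_sumDirac {ι X E : Type*} [Fintype ι] [MeasurableSpace X] [TopologicalSpace X]
    [CompactSpace X] [OpensMeasurableSpace X]
    [NormedAddCommGroup E] [NormedSpace ℝ E] [CompleteSpace E] {p : ι → ℝ} (hp : ∀ i, 0 ≤ p i)
    (hp1 : ∑ i, p i = 1) (x : ι → X) {f : X → E} (hf : Continuous f) :
    ∫ y, f y ∂(sumDirac p hp hp1 x : Measure X) = ∑ i, p i • f (x i) := by
  show ∫ y, f y ∂(∑ i, ENNReal.ofReal (p i) • Measure.dirac (x i)) = _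
  rw [integral_finsetSum_measure fun i _ =>
    (hf.integrable_of_compactSpace _).smul_measure ENNReal.ofReal_ne_top]
  refine Finset.sum_congr rfl fun i _ => ?_
  rw [integral_smul_measure, integral_dirac' _ _ (hf.stronglyMeasurable_of_hasCompactSupport
    (HasCompactSupport.of_compactSpace f)),
    ENNReal.toReal_ofReal (hp i)]

end FiniteMeasures

/-! ### Transfer from matrices to operators on the Hilbert space. -/

section Operators

variable {H : Type*} [NormedAddCommGroup H] [InnerProductSpace ℂ H] [FiniteDimensional ℂ H]

/-- The linear equivalence between matrices and operators. -/
noncomputable def operatorEquiv (b : OrthonormalBasis (Fin 2) ℂ H) :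
    Matrix (Fin 2) (Fin 2) ℂ ≃ₗ[ℂ] (H →L[ℂ] H) :=
  (LinearMap.toMatrixOrthonormal b).symm.toAlgEquiv.toLinearEquiv.trans
    LinearMap.toContinuousLinearMap

theorem operatorEquiv_apply (b : OrthonormalBasis (Fin 2) ℂ H) (A : Matrix (Fin 2) (Fin 2) ℂ) :
    operatorEquiv b A = operatorOfMatrix b A := rfl

theorem operatorEquiv_symm_apply (b : OrthonormalBasis (Fin 2) ℂ H) (A : H →L[ℂ] H)
    (i j : Fin 2) : (operatorEquiv b).symm A i j = inner ℂ (b i) (A (b j)) :=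
  LinearMap.toMatrixOrthonormal_apply_apply b (A : H →ₗ[ℂ] H) i j

theorem trace_operatorEquiv_symm (b : OrthonormalBasis (Fin 2) ℂ H) (A : H →L[ℂ] H) :
    ((operatorEquiv b).symm A).trace = LinearMap.trace ℂ H (A : H →ₗ[ℂ] H) :=
  (LinearMap.trace_eq_matrix_trace ℂ b.toBasis (A : H →ₗ[ℂ] H)).symm

/-- The matrix form of a linear map on operators. -/
noncomputable def matrixMap (b : OrthonormalBasis (Fin 2) ℂ H) :
    ((H →L[ℂ] H) →L[ℂ] (H →L[ℂ] H)) →ₗ[ℂ]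
      (Matrix (Fin 2) (Fin 2) ℂ →ₗ[ℂ] Matrix (Fin 2) (Fin 2) ℂ) where
  toFun φ := (operatorEquiv b).symm ∘ₗ (φ : (H →L[ℂ] H) →ₗ[ℂ] (H →L[ℂ] H)) ∘ₗ
    (operatorEquiv b : Matrix (Fin 2) (Fin 2) ℂ →ₗ[ℂ] (H →L[ℂ] H))
  map_add' φ ψ := by ext; simp
  map_smul' r φ := by ext; simp

theorem matrixMap_apply (b : OrthonormalBasis (Fin 2) ℂ H) (φ : (H →L[ℂ] H) →L[ℂ] (H →L[ℂ] H))
    (A : Matrix (Fin 2) (Fin 2) ℂ) :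
    matrixMap b φ A = (operatorEquiv b).symm (φ (operatorEquiv b A)) := rfl

theorem matrixMap_one (b : OrthonormalBasis (Fin 2) ℂ H) : matrixMap b 1 = LinearMap.id := by
  ext A : 1
  ext; simp [matrixMap_apply]

variable [CompleteSpace H]

/-- A completely positive map, as an element of the algebra of linear maps on operators. -/
noncomputable def CompletelyPositiveMap.toOperator (φ : (H →L[ℂ] H) →CP (H →L[ℂ] H)) :
    (H →L[ℂ] H) →L[ℂ] (H →L[ℂ] H) :=
  LinearMap.toContinuousLinearMap φ.toLinearMap

theorem CompletelyPositiveMap.toOperator_apply (φ : (H →L[ℂ] H) →CP (H →L[ℂ] H)) (A : H →L[ℂ] H) :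
    φ.toOperator A = φ A := rfl

-- Positive elements are generated additively by the products `star Y * Y`, and the scalar block
-- matrix of such a product is `Zᴴ * Z`.
omit [FiniteDimensional ℂ H] in
open scoped ComplexOrder in
theorem posSemidef_of_cstarMatrix_nonneg (b : OrthonormalBasis (Fin 2) ℂ H)
    {N : CStarMatrix (Fin 2) (Fin 2) (H →L[ℂ] H)} (hN : 0 ≤ N) :
    (Matrix.of fun x y : Fin 2 × Fin 2 => inner ℂ (b x.2) (N x.1 y.1 (b y.2))).PosSemidef := by
  rw [StarOrderedRing.nonneg_iff] at hN
  induction hN using AddSubmonoid.closure_induction with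
  | mem N hN =>
    obtain ⟨Y, rfl⟩ := hN
    let Z : Matrix (Fin 2 × Fin 2) (Fin 2 × Fin 2) ℂ :=
      Matrix.of fun x y => inner ℂ (b x.2) (Y x.1 y.1 (b y.2))
    convert Matrix.posSemidef_conjTranspose_mul_self Z using 1
    ext ⟨i, c⟩ ⟨j, d⟩
    simp only [Matrix.of_apply]
    rw [CStarMatrix.mul_apply, sum_apply, inner_sum,
      Matrix.mul_apply, Fintype.sum_prod_type]
    refine Finset.sum_congr rfl fun k _ => ?_
    rw [CStarMatrix.star_apply, ContinuousLinearMap.star_eq_adjoint,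
      mul_apply_eq_comp, ContinuousLinearMap.adjoint_inner_right,
      ← b.sum_inner_mul_inner]
    refine Finset.sum_congr rfl fun m _ => ?_
    simp [Z, Matrix.conjTranspose_apply]
  | zero =>
    convert Matrix.PosSemidef.zero using 1
    ext x y
    simp
  | add M N _ _ hM hN =>
    convert hM.add hN using 1
    ext x y
    simp

open scoped ComplexOrder in
/-- The Choi matrix of a completely positive map is positive semidefinite. -/
theorem posSemidef_choiMatrix (b : OrthonormalBasis (Fin 2) ℂ H)
    (φ : (H →L[ℂ] H) →CP (H →L[ℂ] H)) :
    (choiMatrix (matrixMap b φ.toOperator)).PosSemidef := by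
  -- With the matrix units `e₀ⱼ` in its first row and zeros in the second, `star R * R` is the block
  -- matrix of all matrix units, which is therefore positive.
  let R : CStarMatrix (Fin 2) (Fin 2) (H →L[ℂ] H) := CStarMatrix.ofMatrix (Matrix.of fun i j =>
    if i = 0 then operatorOfMatrix b (Matrix.single 0 j 1) else 0)
  have hR (i j : Fin 2) : (star R * R) i j = operatorOfMatrix b (Matrix.single i j 1) := by
    rw [CStarMatrix.mul_apply, Fin.sum_univ_two, CStarMatrix.star_apply, CStarMatrix.star_apply]
    have h0 (j : Fin 2) : R 0 j = operatorOfMatrix b (Matrix.single 0 j 1) := rfl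
    have h1 (j : Fin 2) : R 1 j = 0 := rfl
    rw [h0, h0, h1, h1, mul_zero, add_zero, ← operatorOfMatrix_star, ← operatorOfMatrix_mul,
      Matrix.star_eq_conjTranspose, Matrix.conjTranspose_single, star_one,
      Matrix.single_mul_single_same, mul_one]
  have h := posSemidef_of_cstarMatrix_nonneg b
    (CompletelyPositiveMap.map_cstarMatrix_nonneg φ (star R * R) (star_mul_self_nonneg R))
  convert h using 1
  ext ⟨i, c⟩ ⟨j, d⟩
  rw [Matrix.of_apply, CStarMatrix.map_apply, hR]
  exact operatorEquiv_symm_apply _ _ _ _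

/-- The defining representation of `SU(2)`, with values in the algebra of operators. -/
noncomputable def definingHom (b : OrthonormalBasis (Fin 2) ℂ H) : SU2 →* (H →L[ℂ] H) :=
  (unitary (H →L[ℂ] H)).subtype.comp (definingRep b : SU2 →* unitary (H →L[ℂ] H))

theorem continuous_definingHom (b : OrthonormalBasis (Fin 2) ℂ H) : Continuous (definingHom b) :=
  (continuous_operatorOfMatrix b).comp continuous_subtype_val

/-- The adjoint action of `SU(2)` on operators. -/
noncomputable def adjointHom (b : OrthonormalBasis (Fin 2) ℂ H) :
    SU2 →* ((H →L[ℂ] H) →L[ℂ] (H →L[ℂ] H)) where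
  toFun g := ContinuousLinearMap.mulLeftRight ℂ (H →L[ℂ] H) (definingHom b g)
    (star (definingHom b g))
  map_one' := by ext A : 1; simp
  map_mul' g h := by ext A : 1; simp [mul_assoc]

theorem adjointHom_apply (b : OrthonormalBasis (Fin 2) ℂ H) (g : SU2) (A : H →L[ℂ] H) :
    adjointHom b g A = definingHom b g * A * star (definingHom b g) := by
  simp [adjointHom]

theorem continuous_adjointHom (b : OrthonormalBasis (Fin 2) ℂ H) : Continuous (adjointHom b) := by
  have := continuous_definingHom b
  exact ((ContinuousLinearMap.mulLeftRight ℂ (H →L[ℂ] H)).continuous.comp this).clm_apply this.star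

theorem integralHom_adjointHom_apply (b : OrthonormalBasis (Fin 2) ℂ H)
    (μ : ProbabilityMeasure SU2) (A : H →L[ℂ] H) :
    integralHom (adjointHom b) (continuous_adjointHom b) μ A =
      ∫ g, definingHom b g * A * star (definingHom b g) ∂(μ : Measure SU2) := by
  rw [integralHom_apply, ContinuousLinearMap.integral_apply
    ((continuous_adjointHom b).integrable_of_compactSpace _)]
  simp_rw [adjointHom_apply]

/-- The only probability measure on `SU(2)` whose mean is the identity is the unit mass at the
identity. -/
theorem eq_one_of_integralHom_definingHom_eq_one (b : OrthonormalBasis (Fin 2) ℂ H)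
    (μ : ProbabilityMeasure SU2)
    (h : integralHom (definingHom b) (continuous_definingHom b) μ = 1) : μ = 1 := by
  -- The real part of the corner entry is at most `1` on `SU(2)`, with equality only at the
  -- identity; if its mean is `1`, it equals `1` almost everywhere.
  let l : (H →L[ℂ] H) →L[ℝ] ℝ := Complex.reCLM.comp
    ((((innerSL ℂ (b 0)).comp (ContinuousLinearMap.apply ℂ H (b 0))).restrictScalars ℝ))
  have hl (g : SU2) : l (definingHom b g) = (g.1 0 0).re := by
    have : (operatorEquiv b).symm (operatorEquiv b g.1) 0 0 = _ := operatorEquiv_symm_apply _ _ _ _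
    rw [LinearEquiv.symm_apply_apply] at this
    rw [this]
    rfl
  have hc : Continuous (fun g : SU2 => g.1) := continuous_subtype_val
  have hint : Integrable (fun g : SU2 => (g.1 0 0).re) (μ : Measure SU2) :=
    Continuous.integrable_of_compactSpace
      (Complex.continuous_re.comp (hc.matrix_elem 0 0)) _
  have h1 : ∫ g, (g.1 0 0).re ∂(μ : Measure SU2) = 1 := by
    simp_rw [← hl]
    rw [l.integral_comp_comm ((continuous_definingHom b).integrable_of_compactSpace _),
      ← integralHom_apply _ (continuous_definingHom b), h]
    simp [l]
  have h2 : ∫ g, (1 - (g.1 0 0).re) ∂(μ : Measure SU2) = 0 := by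
    rw [integral_sub (integrable_const _) hint, h1]
    simp
  rw [integral_eq_zero_iff_of_nonneg (fun g => sub_nonneg.2 (SU2.re_apply_zero_le g))
    ((integrable_const _).sub hint)] at h2
  have h3 : (fun g => g) =ᵐ[(μ : Measure SU2)] fun _ => 1 := by
    filter_upwards [h2] with g hg
    exact SU2.eq_one_of_re_eq_one (sub_eq_zero.1 hg).symm
  refine Subtype.ext ?_
  have h4 : Measure.map (fun g : SU2 => g) (μ : Measure SU2) = Measure.map (fun _ => 1) _ :=
    Measure.map_congr h3
  rw [Measure.map_id', Measure.map_const, measure_univ, one_smul] at h4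
  exact h4

/-- A unital quantum channel of a two-level system is a mixture of conjugations by elements of
`SU(2)` whose mean is close to the identity if the channel is. -/
theorem exists_integralHom_adjointHom_eq (b : OrthonormalBasis (Fin 2) ℂ H) :
    ∃ C : ℝ, ∀ φ : (H →L[ℂ] H) →CP (H →L[ℂ] H),
      (∀ A : H →L[ℂ] H, LinearMap.trace ℂ H (φ A : H →ₗ[ℂ] H)
        = LinearMap.trace ℂ H (A : H →ₗ[ℂ] H)) → φ 1 = 1 →
      ∃ ν : ProbabilityMeasure SU2,
        integralHom (adjointHom b) (continuous_adjointHom b) ν = φ.toOperator ∧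
        ‖integralHom (definingHom b) (continuous_definingHom b) ν - 1‖
          ≤ C * ‖φ.toOperator - 1‖ := by
  -- Reading off a coefficient is a linear functional on a finite-dimensional space, hence bounded;
  -- this makes the constant independent of the channel.
  let D (j : Fin 4) : ((H →L[ℂ] H) →L[ℂ] (H →L[ℂ] H)) →L[ℂ] ℂ :=
    LinearMap.toContinuousLinearMap
      ((LinearMap.proj j ∘ₗ LinearMap.proj 0) ∘ₗ processMatrix ∘ₗ matrixMap b)
  have hD (j : Fin 4) (φ) : D j φ = processMatrix (matrixMap b φ) 0 j := rfl
  let F (j : Fin 4) : H →L[ℂ] H := operatorEquiv b (quaternionMatrix (Pi.single j 1))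
  have hF0 : F 0 = 1 := by
    simp only [F, operatorEquiv_apply]
    rw [← operatorOfMatrix_one b]
    congr 1
    ext i j
    fin_cases i <;> fin_cases j <;> simp [quaternionMatrix]
  refine ⟨∑ j, (‖D j‖ + ‖D 0‖) * ‖F j‖, fun φ htr h1 => ?_⟩
  obtain ⟨p, v, hp, hp1, hv, hsum, hbound⟩ :=
    exists_sum_conj_quaternionMatrix (posSemidef_choiMatrix b φ)
      (fun A => by
        rw [matrixMap_apply, trace_operatorEquiv_symm, φ.toOperator_apply, htr,
          ← trace_operatorEquiv_symm b, LinearEquiv.symm_apply_apply])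
      (by rw [matrixMap_apply, operatorEquiv_apply, operatorOfMatrix_one, φ.toOperator_apply, h1,
            ← operatorOfMatrix_one b, ← operatorEquiv_apply, LinearEquiv.symm_apply_apply])
  let g (i : Fin 4) : SU2 := ⟨quaternionMatrix (v i), quaternionMatrix_mem (hv i)⟩
  have hg (i : Fin 4) : definingHom b (g i) = operatorEquiv b (quaternionMatrix (v i)) := rfl
  refine ⟨sumDirac p hp hp1 g, ?_, ?_⟩
  · rw [integralHom_apply, integral_sumDirac hp hp1 g (continuous_adjointHom b)]
    ext A : 1
    have h := congrArg (operatorEquiv b) (hsum ((operatorEquiv b).symm A))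
    rw [matrixMap_apply, LinearEquiv.apply_symm_apply, LinearEquiv.apply_symm_apply, map_sum] at h
    rw [h, sum_apply]
    refine Finset.sum_congr rfl fun i _ => ?_
    rw [map_smul, operatorEquiv_apply, operatorOfMatrix_mul, operatorOfMatrix_mul,
      operatorOfMatrix_star, ← operatorEquiv_apply, ← operatorEquiv_apply, ← hg,
      LinearEquiv.apply_symm_apply, ← adjointHom_apply, Complex.coe_smul]
    rfl
  · rw [integralHom_apply, integral_sumDirac hp hp1 g (continuous_definingHom b)]
    have h : ∑ i, p i • definingHom b (g i) - 1 =
        ∑ j, ((∑ i, p i * v i j - Pi.single (M := fun _ => ℝ) 0 1 j : ℝ) : ℂ) • F j := by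
      simp only [Complex.ofReal_sub, sub_smul, Finset.sum_sub_distrib]
      congr 1
      · simp only [hg]
        simp_rw [quaternionMatrix_eq_sum (v _), map_sum, map_smul, Complex.ofReal_sum,
          Finset.sum_smul, Finset.smul_sum]
        rw [Finset.sum_comm]
        refine Finset.sum_congr rfl fun j _ => Finset.sum_congr rfl fun i _ => ?_
        rw [Complex.ofReal_mul, mul_smul, Complex.coe_smul, Complex.coe_smul]
      · rw [Finset.sum_eq_single 0 (fun j _ hj => by simp [Pi.single_eq_of_ne hj]) (by simp),
          hF0]
        simp
    rw [h, Finset.sum_mul]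
    refine norm_sum_le_of_le _ fun j _ => ?_
    rw [norm_smul, Complex.norm_real, Real.norm_eq_abs, mul_right_comm]
    refine mul_le_mul_of_nonneg_right ?_ (norm_nonneg _)
    have h2 := hbound j
    rw [← matrixMap_one b, ← map_sub, ← hD, ← hD] at h2
    rw [add_mul]
    exact h2.trans (add_le_add ((D j).le_opNorm _) ((D 0).le_opNorm _))

end Operators

/-! ### Lipschitz bound at zero for norm-continuous semigroups. -/

section OneParameterSemigroups

variable {B : Type*} [NormedRing B]

/-- Summing the geometric identity gives `k (x - 1) = (x ^ k - 1) - ∑ (x - 1) (x ^ i - 1)`, so `k ‖x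
- 1‖ ≤ 1/2 + k ‖x - 1‖ / 2`. This yields a Lipschitz bound without introducing a generator. -/
theorem mul_norm_sub_one_le_one [NormedAlgebra ℝ B] {x : B} {k : ℕ}
    (h : ∀ i ≤ k, ‖x ^ i - 1‖ ≤ 1 / 2) : k * ‖x - 1‖ ≤ 1 := by
  have h1 : k • (x - 1) = (x ^ k - 1) - ∑ i ∈ Finset.range k, (x - 1) * (x ^ i - 1) := by
    simp_rw [mul_sub (x - 1), Finset.sum_sub_distrib, ← Finset.mul_sum, mul_geom_sum]
    simp [nsmul_eq_mul, Nat.cast_comm]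
  have h2 : ‖∑ i ∈ Finset.range k, (x - 1) * (x ^ i - 1)‖ ≤
      ∑ _i ∈ Finset.range k, ‖x - 1‖ * (1 / 2) := by
    refine norm_sum_le_of_le _ fun i hi => (norm_mul_le _ _).trans ?_
    exact mul_le_mul_of_nonneg_left (h i (Finset.mem_range.1 hi).le) (norm_nonneg _)
  rw [Finset.sum_const, Finset.card_range, nsmul_eq_mul] at h2
  have h3 : k * ‖x - 1‖ = ‖k • (x - 1)‖ := by
    rw [← Nat.cast_smul_eq_nsmul ℝ, norm_smul]
    simp
  have h4 := norm_sub_le (x ^ k - 1) (∑ i ∈ Finset.range k, (x - 1) * (x ^ i - 1))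
  rw [← h1, ← h3] at h4
  linarith [h k le_rfl]

variable {T : ℝ≥0 → B} (hadd : ∀ t s, T (t + s) = T t * T s) (h0 : T 0 = 1)
include hadd h0

theorem semigroup_natCast_mul (k : ℕ) (t : ℝ≥0) : T (k * t) = T t ^ k := by
  induction k with
  | zero => simp [h0]
  | succ k ih => rw [Nat.cast_succ, add_mul, one_mul, hadd, ih, pow_succ]

/-- A norm-continuous one-parameter semigroup is Lipschitz at dyadic times tending to zero. -/
theorem exists_norm_semigroup_sub_one_le [NormedAlgebra ℝ B] (hT : Tendsto T (𝓝 0) (𝓝 1)) :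
    ∃ C : ℝ, ∀ᶠ n : ℕ in atTop, ‖T (2 ^ n)⁻¹ - 1‖ ≤ C / 2 ^ n := by
  obtain ⟨δ, hδ, hball⟩ := Metric.tendsto_nhds_nhds.1 hT (1 / 2) (by norm_num)
  obtain ⟨m, hm⟩ := exists_pow_lt_of_lt_one hδ (by norm_num : (1 / 2 : ℝ) < 1)
  -- With `2⁻ᵐ < δ`, the powers of `T (2 ^ (m + l))⁻¹` up to `2 ^ l` stay at times at most `2⁻ᵐ`,
  -- where `T` is within `1/2` of `1`.
  refine ⟨2 ^ m, eventually_atTop.2 ⟨m, fun n hn => ?_⟩⟩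
  obtain ⟨l, rfl⟩ := Nat.exists_eq_add_of_le hn
  have h := mul_norm_sub_one_le_one (x := T (2 ^ (m + l))⁻¹) (k := 2 ^ l) fun i hi => by
    rw [← semigroup_natCast_mul hadd h0, ← dist_eq_norm]
    refine (hball ?_).le
    rw [NNReal.dist_eq, NNReal.coe_zero, sub_zero, NNReal.abs_eq]
    refine lt_of_le_of_lt ?_ hm
    have hi' : (i : ℝ) ≤ 2 ^ l := by exact_mod_cast hi
    push_cast
    rw [pow_add, one_div, inv_pow, mul_inv, mul_comm (_ ^ m)⁻¹, ← mul_assoc]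
    refine mul_le_of_le_one_left (by positivity) ?_
    rw [← div_eq_mul_inv]
    exact (div_le_one (by positivity)).2 hi'
  rw [le_div_iff₀ (by positivity)]
  push_cast at h
  calc _ = 2 ^ m * (2 ^ l * ‖T (2 ^ (m + l))⁻¹ - 1‖) := by rw [pow_add]; ring
    _ ≤ 2 ^ m := mul_le_of_le_one_right (by positivity) h

end OneParameterSemigroups

/-! ### Unital semigroups are twirling semigroups. -/

namespace QuantumDynamicalSemigroup

variable {H : Type u} [NormedAddCommGroup H] [InnerProductSpace ℂ H] [CompleteSpace H]

theorem IsTwirledBy.isUnital {S : QuantumDynamicalSemigroup H} {G : Type*} [Group G]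
    [TopologicalSpace G] [MeasurableSpace G] [BorelSpace G] {π : G →ₜ* unitary (H →L[ℂ] H)}
    {μ : ConvolutionSemigroup G} (h : S.IsTwirledBy π μ) : S.IsUnital := by
  intro t
  rw [h t 1]
  simp

variable [FiniteDimensional ℂ H]

theorem toOperator_add (S : QuantumDynamicalSemigroup H) (t s : ℝ≥0) :
    (S.map (t + s)).toOperator = (S.map t).toOperator * (S.map s).toOperator := by
  ext A : 1
  exact S.map_add t s A

theorem toOperator_zero (S : QuantumDynamicalSemigroup H) : (S.map 0).toOperator = 1 := by
  ext A : 1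
  exact S.map_zero A

theorem tendsto_toOperator (S : QuantumDynamicalSemigroup H) :
    Tendsto (fun t => (S.map t).toOperator) (𝓝 0) (𝓝 1) := by
  have h : ContinuousWithinAt (fun t => (S.map t).toOperator) (Set.Ioi 0) 0 := by
    rw [continuousWithinAt_clm_apply]
    intro A
    have := S.tendsto_zero A
    rw [ContinuousWithinAt, toOperator_zero]
    exact this
  -- Adjoining the point `0` to the positive times gives all of `ℝ≥0`, which turns the one-sided
  -- limit into a full one.
  rw [← continuousWithinAt_insert_self, Set.Ioi_insert, ← bot_eq_zero, Set.Ici_bot,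
    continuousWithinAt_univ, ContinuousAt, bot_eq_zero, toOperator_zero] at h
  exact h

/-- A unital quantum dynamical semigroup of a two-level system is a twirling semigroup for the
defining representation of `SU(2)`. -/
theorem IsUnital.exists_isTwirledBy {S : QuantumDynamicalSemigroup H} (hS : S.IsUnital)
    (b : OrthonormalBasis (Fin 2) ℂ H) :
    ∃ μ : ConvolutionSemigroup SU2, S.IsTwirledBy (definingRep b) μ := by
  obtain ⟨C, hC⟩ := exists_integralHom_adjointHom_eq b
  obtain ⟨K, hK⟩ := exists_norm_semigroup_sub_one_le S.toOperator_add S.toOperator_zero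
    S.tendsto_toOperator
  choose ν hν hνC using fun n : ℕ => hC (S.map (2 ^ n)⁻¹) (S.trace_map _) (hS _)
  obtain ⟨μ, U, hU, hμ⟩ := exists_convolutionSemigroup_tendsto
    (eq_one_of_integralHom_definingHom_eq_one b) ν (fun n => 2 ^ n)
    (tendsto_pow_atTop_atTop_of_one_lt one_lt_two) (max C 0 * K) (by
      filter_upwards [hK] with n hn
      refine (hνC n).trans ?_
      rw [mul_div_assoc]
      exact (mul_le_mul_of_nonneg_right (le_max_left C 0) (norm_nonneg _)).trans
        (mul_le_mul_of_nonneg_left hn (le_max_right C 0)))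
  refine ⟨μ, fun t A => ?_⟩
  have h1 := ((continuous_integralHom _ (continuous_adjointHom b)).tendsto _).comp (hμ t)
  -- The multiple of `2⁻ⁿ` just below `t`: the power `ν n ^ ⌊2ⁿ t⌋₊` represents the channel at time
  -- `r n`.
  let r (n : ℕ) : ℝ≥0 := (⌊(2 : ℝ) ^ n * t⌋₊ : ℝ≥0) * (2 ^ n)⁻¹
  have hr (n : ℕ) : r n ≤ t := by
    rw [← NNReal.coe_le_coe]
    simp only [r]
    push_cast
    rw [← div_eq_mul_inv, div_le_iff₀ (by positivity), mul_comm (t : ℝ)]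
    exact Nat.floor_le (by positivity)
  have hr' (n : ℕ) : t - r n ≤ (2 ^ n)⁻¹ := by
    rw [tsub_le_iff_right, ← NNReal.coe_le_coe]
    simp only [r]
    push_cast
    rw [← one_add_mul, ← div_eq_mul_inv, le_div_iff₀ (by positivity), mul_comm (t : ℝ), add_comm]
    exact (Nat.lt_floor_add_one _).le
  have h2 : Tendsto (fun n => t - r n) U (𝓝 0) := by
    refine tendsto_of_tendsto_of_tendsto_of_le_of_le tendsto_const_nhds ?_ (fun _ => zero_le) hr'
    simp_rw [← inv_pow]
    refine Tendsto.mono_left ?_ hU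
    rw [← NNReal.tendsto_coe]
    push_cast
    exact tendsto_pow_atTop_nhds_zero_of_lt_one (by norm_num) (by norm_num)
  -- Each product is the channel at time `(t - r n) + r n = t`, so the sequence is constant and its
  -- limit identifies the twirl by `μ.measure t`.
  have h3 := (S.tendsto_toOperator.comp h2).mul h1
  have h4 : (S.map t).toOperator =
      integralHom (adjointHom b) (continuous_adjointHom b) (μ.measure t) := by
    rw [one_mul] at h3
    refine tendsto_nhds_unique (Tendsto.congr (fun n => ?_) tendsto_const_nhds) h3
    simp only [Function.comp_apply, map_pow]
    rw [hν, ← semigroup_natCast_mul (T := fun t => (S.map t).toOperator) S.toOperator_add S.toOperator_zero, ← S.toOperator_add,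
      tsub_add_cancel_of_le (hr n)]
  rw [← CompletelyPositiveMap.toOperator_apply, h4, integralHom_adjointHom_apply]
  rfl

theorem IsUnital.isTwirlingSemigroup (hdim : Module.finrank ℂ H = 2)
    {S : QuantumDynamicalSemigroup H} (hS : S.IsUnital) : IsTwirlingSemigroup.{u, v} S := by
  let b : OrthonormalBasis (Fin 2) ℂ H := (stdOrthonormalBasis ℂ H).reindex (finCongr hdim)
  obtain ⟨μ, hμ⟩ := hS.exists_isTwirledBy b
  -- The group must live in the universe `v`, hence a lifted copy of `SU(2)` and the push-forward of
  -- `μ` to it.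
  let hm : MeasurableSpace (ULift.{v} SU2) := borel _
  have hB : BorelSpace (ULift.{v} SU2) := ⟨rfl⟩
  have hG : IsTopologicalGroup (ULift.{v} SU2) :=
    { continuous_mul := continuous_uliftUp.comp
        ((continuous_uliftDown.comp continuous_fst).mul (continuous_uliftDown.comp continuous_snd))
      continuous_inv := continuous_uliftUp.comp continuous_uliftDown.inv }
  have hSC : SecondCountableTopology (ULift.{v} SU2) :=
    Homeomorph.ulift.secondCountableTopology
  have hLC : LocallyCompactSpace (ULift.{v} SU2) :=
    Homeomorph.ulift.isClosedEmbedding.locallyCompactSpace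
  let π : ULift.{v} SU2 →ₜ* unitary (H →L[ℂ] H) :=
    { toFun := fun g => definingRep b g.down
      map_one' := map_one (definingRep b)
      map_mul' := fun g h => map_mul (definingRep b) g.down h.down
      continuous_toFun := (map_continuous (definingRep b)).comp continuous_uliftDown }
  refine ⟨ULift.{v} SU2, inferInstance, inferInstance, hG, hLC, hSC, inferInstance, hm, hB, π,
    μ.map (MulEquiv.ulift.symm : SU2 ≃* ULift.{v} SU2).toMonoidHom continuous_uliftUp,
    fun t A => ?_⟩
  rw [hμ t A]
  have hc : Continuous fun g => (π g : H →L[ℂ] H) * A * star (π g : H →L[ℂ] H) := by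
    have : Continuous fun g => (π g : H →L[ℂ] H) :=
      continuous_subtype_val.comp (map_continuous π)
    exact (this.mul continuous_const).mul this.star
  show _ = ∫ g, _ ∂(Measure.map ULift.up (μ.measure t : Measure SU2))
  rw [integral_map continuous_uliftUp.measurable.aemeasurable hc.aestronglyMeasurable]
  rfl

end QuantumDynamicalSemigroup

theorem mainTheorem4 {H : Type u} [NormedAddCommGroup H] [InnerProductSpace ℂ H]
    [CompleteSpace H] [FiniteDimensional ℂ H] (hdim : Module.finrank ℂ H = 2)
    (S : QuantumDynamicalSemigroup H) :
    (∀ E ∈ quantumEntropies H,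
      S.DoesNotDecrease E ↔ QuantumDynamicalSemigroup.IsTwirlingSemigroup.{u, v} S) ∧
    (QuantumDynamicalSemigroup.IsTwirlingSemigroup.{u, v} S →
      ∀ b : OrthonormalBasis (Fin 2) ℂ H,
        ∃ μ : ConvolutionSemigroup SU2, S.IsTwirledBy (definingRep b) μ) := by
  have h : QuantumDynamicalSemigroup.IsTwirlingSemigroup.{u, v} S ↔ S.IsUnital := by
    refine ⟨?_, fun h => h.isTwirlingSemigroup hdim⟩
    rintro ⟨G, _, _, _, _, _, _, _, _, π, μ, hμ⟩
    exact hμ.isUnital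
  exact ⟨fun E hE => (S.doesNotDecrease_iff_isUnital hdim hE).trans h.symm,
    fun hS b => (h.1 hS).exists_isTwirledBy b⟩
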